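/- Let $0<\varepsilon<1/2$ and $q\in(0,1]$. For each $n\ge 1$ let $G_n$ be a connected graph on $n$ vertices with minimum degree $\delta_n$, maximum degree $\Delta_n$ and adjacency eigenvalues $\mu_1\ge\mu_2\ge\dots\ge\mu_n$, and put $\lambda_n=\max_{2\le i\le n}|\mu_i|$. Assume that $(G_n)_{n\ge1}$ is an expander sequence, i.e. $\Delta_n/\delta_n=1+o(1)$ and $\lambda_n=o(\Delta_n)$ as $n\to\infty$. Let $\tilde G_n$ be obtained from $G_n$ by deleting edges so that each vertex keeps at least a $(1/2+\varepsilon)$ fraction of its edges. Both of the following protocols on $\tilde G_n$ start with a single informed vertex $v$ and proceed in rounds. In each round every vertex calls a neighbour in $\tilde G_n$ chosen uniformly at random, and the transmission over each call succeeds with probability $q$, where all choices and successes, over all vertices and rounds, are independent. In push, if $u$ is informed, calls $w$, and the transmission succeeds, then $w$ becomes informed (calls of uninformed vertices have no effect). In push&pull (pp), if $u$ calls $w$, the transmission succeeds, and at least one of $u,w$ was informed at the beginning of the round, then both become informed. For $\mathcal P\in\{push,pp\}$ let $\tilde T_{\mathcal P}(\tilde G_n)$ be the number of rounds until at least $n-n/\log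 n$ vertices are informed ($\log$ is the natural logarithm). Then, with probability tending to $1$ as $n\to\infty$, uniformly in the choice of the initially informed vertex $v$: (a) $\tilde T_{push}(\tilde G_n)=\log_{1+q}(n)+o(\log n)$; (b) if additionally there is $\alpha\in(0,1]$ with $\delta_n\ge\alpha n$ for all sufficiently large $n$, then $\tilde T_{pp}(\tilde G_n)\le\log_{1+2q}(n)+o(\log n)$. Here $X_n=b_n+o(\log n)$ (respectively $X_n\le b_n+o(\log n)$) with probability tending to $1$ means that there is a positive deterministic function $g(n)=o(\log n)$ such that $\mathbb P\big(b_n-g(n)\le X_n\le b_n+g(n)\big)\to1$ (respectively $\mathbb P\big(X_n\le b_n+g(n)\big)\to1$). -/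

import Mathlib

open MeasureTheory Filter Topology Asymptotics

namespace RumourSpreading

/-- `λ = max_{2 ≤ i ≤ n} |μ_i|`, where `μ_1 ≥ ... ≥ μ_n` are the eigenvalues of the adjacency matrix
(the index `0` of the antitone family `eigenvalues₀` is `μ_1`; the value is `0` if `n ≤ 1`). -/
noncomputable def secondEigenvalue {n : ℕ} (G : SimpleGraph (Fin n)) [DecidableRel G.Adj] : ℝ :=
  ⨆ i : {i : Fin (Fintype.card (Fin n)) // (i : ℕ) ≠ 0},
    |(G.isHermitian_adjMatrix ℝ).eigenvalues₀ i|

/-- Expander sequences: `G n` is a connected graph on `n` vertices (for `n ≥ 1`), and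
`Δ_n / δ_n = 1 + o(1)`, `λ_n = o(Δ_n)`. -/
structure IsExpanderSequence (G : (n : ℕ) → SimpleGraph (Fin n))
    [∀ n, DecidableRel (G n).Adj] : Prop where
  connected : ∀ n, 1 ≤ n → (G n).Connected
  degree_ratio : Tendsto (fun n => ((G n).maxDegree : ℝ) / ((G n).minDegree : ℝ)) atTop (𝓝 1)
  eigenvalue_isLittleO :
    (fun n => secondEigenvalue (G n)) =o[atTop] (fun n => ((G n).maxDegree : ℝ))

/-- `H` arises from `G` by deleting edges such that every vertex keeps at least a fraction `c`
of its edges. -/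
structure IsDeletion {n : ℕ} (c : ℝ) (G H : SimpleGraph (Fin n))
    [DecidableRel G.Adj] [DecidableRel H.Adj] : Prop where
  le : H ≤ G
  degree_le : ∀ v, c * (G.degree v : ℝ) ≤ (H.degree v : ℝ)

/-- The law of the vertex called by `v`: a uniformly random neighbour of `v`
(an isolated vertex calls itself, which has no effect). -/
noncomputable def contactLaw {n : ℕ} (G : SimpleGraph (Fin n)) [DecidableRel G.Adj]
    (v : Fin n) : PMF (Fin n) :=
  if h : (G.neighborFinset v).Nonempty then PMF.uniformOfFinset (G.neighborFinset v) h
  else PMF.pure v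

/-- The calls of one round: the vertex `v` calls `(c v).1`, and the transmission over this call
succeeds iff `(c v).2 = true`. -/
abbrev Calls (n : ℕ) : Type := Fin n → Fin n × Bool

/-- The law of the calls of one round: independently over the vertices `v`, the called vertex is a
uniformly random neighbour, and, independently of it, the transmission succeeds with
probability `q`. -/
noncomputable def roundLaw {n : ℕ} (G : SimpleGraph (Fin n)) [DecidableRel G.Adj]
    (q : unitInterval) : Measure (Calls n) :=
  Measure.pi fun v =>
    (contactLaw G v).toMeasure.prod (ProbabilityTheory.bernoulliMeasure true false q)

instance {n : ℕ} (G : SimpleGraph (Fin n)) [DecidableRel G.Adj] (q : unitInterval) :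
    IsProbabilityMeasure (roundLaw G q) := by
  unfold roundLaw
  infer_instance

/-- The law of the calls of all rounds, which are independent and identically distributed. -/
noncomputable def callsLaw {n : ℕ} (G : SimpleGraph (Fin n)) [DecidableRel G.Adj]
    (q : unitInterval) : Measure (ℕ → Calls n) :=
  Measure.infinitePi fun _ => roundLaw G q

instance {n : ℕ} (G : SimpleGraph (Fin n)) [DecidableRel G.Adj] (q : unitInterval) :
    IsProbabilityMeasure (callsLaw G q) := by
  unfold callsLaw
  infer_instance

/-- One round of push: every informed vertex informs the vertex it calls,
if the transmission succeeds. -/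
def pushStep {n : ℕ} (I : Finset (Fin n)) (c : Calls n) : Finset (Fin n) :=
  I ∪ Finset.univ.filter fun w => ∃ u ∈ I, c u = (w, true)

/-- One round of push&pull: whenever `u` calls `w`, the transmission succeeds, and one of
`u`, `w` is informed, both become informed. -/
def pushPullStep {n : ℕ} (I : Finset (Fin n)) (c : Calls n) : Finset (Fin n) :=
  I ∪ Finset.univ.filter fun w => (∃ u ∈ I, c u = (w, true)) ∨ (∃ u ∈ I, c w = (u, true))

/-- The set of informed vertices after `t` rounds of the protocol with one-round rule `step`,
if initially exactly `v` is informed. -/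
def informed {n : ℕ} (step : Finset (Fin n) → Calls n → Finset (Fin n)) (v : Fin n)
    (ω : ℕ → Calls n) : ℕ → Finset (Fin n)
  | 0 => {v}
  | t + 1 => step (informed step v ω t) (ω t)

/-- The number of rounds needed to inform at least `n - n / log n` vertices
(`⊤` if this never happens). -/
noncomputable def almostAllTime {n : ℕ} (step : Finset (Fin n) → Calls n → Finset (Fin n))
    (v : Fin n) (ω : ℕ → Calls n) : ℕ∞ :=
  ⨅ (t : ℕ) (_ : (n : ℝ) - n / Real.log n ≤ ((informed step v ω t).card : ℝ)), (t : ℕ∞)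

end RumourSpreading

/-!
The informed sets `J` form a Markov chain; let `φ` be a weight on the vertices. In one round the
events that single vertices outside `J` become informed are pairwise negatively correlated, so the
weight of `J` is concentrated around its mean: if it grows by a factor `1 + γ` in expectation, then
its expected *reciprocal* shrinks by almost the same factor. Markov's inequality for the reciprocal
bounds the time that is needed to leave the small sets.

Since every vertex keeps more than half of its edges, expander mixing yields a linear expected gain
across every cut of the remaining graph. This informs the first constantly many vertices, and all
but `n / log n` vertices once linearly many are informed, in `o(log n)` rounds. In between, `J` has
at most a small linear size, few vertices receive more than one call, and push (with `φ = 1`) grows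
by the factor `1 + q - ξ`. For push&pull, up to the factor `q`, the rates at which information is
exchanged form the symmetric matrix `D⁻¹ A + A D⁻¹`. Its entries sum to `2 n`, so its top eigenvalue
is at least `2`, and in the dense case a nonnegative vector `φ` with `(D⁻¹ A + A D⁻¹) φ ≥ 2 φ` can
be smoothed until it is bounded between positive constants. With this weight push&pull grows by the
factor `1 + 2 q - ξ`.

Conversely, one round of push multiplies the expected number of informed vertices by at most
`1 + q`, which gives the lower bound by Markov's inequality.
-/

namespace RumourSpreading

section RandomIteration

variable {σ β : Type*} [MeasurableSpace β] (ν : Measure β) (step : σ → β → σ)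

/-- The transition operator of the Markov chain `a ↦ step a b` with `b` drawn from `ν`. -/
noncomputable def transition (f : σ → ℝ) (a : σ) : ℝ :=
  ∫ b, f (step a b) ∂ν

/-- The probability that the Markov chain `a ↦ step a b` with `b` drawn from `ν` is outside `A`
at time `t`, as a function of its initial state. -/
noncomputable def failProb (A : Set σ) (t : ℕ) : σ → ℝ :=
  (transition ν step)^[t] (Aᶜ.indicator 1)

variable {ν step}

lemma transition_const_mul (r : ℝ) (f : σ → ℝ) :
    transition ν step (fun a => r * f a) = fun a => r * transition ν step f a :=
  funext fun _ => integral_const_mul _ _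

lemma iterate_transition_const_mul (r : ℝ) (f : σ → ℝ) (t : ℕ) :
    (transition ν step)^[t] (fun a => r * f a) = fun a => r * (transition ν step)^[t] f a := by
  induction t with
  | zero => rfl
  | succ t ih => simp only [Function.iterate_succ_apply', ih, transition_const_mul]

section Finite

variable [Finite β] [MeasurableSingletonClass β] [IsProbabilityMeasure ν]

lemma transition_const_add (r : ℝ) (f : σ → ℝ) :
    transition ν step (fun a => r + f a) = fun a => r + transition ν step f a := by
  funext a
  simp [transition, integral_add (Integrable.of_finite (μ := ν)) .of_finite]

lemma iterate_transition_const_add (r : ℝ) (f : σ → ℝ) (t : ℕ) :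
    (transition ν step)^[t] (fun a => r + f a) = fun a => r + (transition ν step)^[t] f a := by
  induction t with
  | zero => rfl
  | succ t ih => simp only [Function.iterate_succ_apply', ih, transition_const_add]

lemma failProb_le_one (A : Set σ) (t : ℕ) (a : σ) : failProb ν step A t a ≤ 1 := by
  induction t generalizing a with
  | zero => exact Set.indicator_le' (fun _ _ => le_rfl) (fun _ _ => zero_le_one) a
  | succ t ih =>
    rw [failProb, Function.iterate_succ_apply']
    calc ∫ b, failProb ν step A t (step a b) ∂ν ≤ ∫ _, 1 ∂ν :=
          integral_mono .of_finite .of_finite fun b => ih (step a b)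
      _ = 1 := by simp

variable [Preorder σ]

lemma transition_mono {f g : σ → ℝ} {a : σ} (hstep : ∀ a b, a ≤ step a b)
    (hfg : ∀ b, a ≤ b → f b ≤ g b) : transition ν step f a ≤ transition ν step g a :=
  integral_mono .of_finite .of_finite fun b => hfg _ (hstep a b)

lemma iterate_transition_mono {f g : σ → ℝ} {a : σ} (hstep : ∀ a b, a ≤ step a b)
    (hfg : ∀ b, a ≤ b → f b ≤ g b) (t : ℕ) :
    (transition ν step)^[t] f a ≤ (transition ν step)^[t] g a := by
  induction t generalizing a with
  | zero => exact hfg _ le_rfl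
  | succ t ih =>
    rw [Function.iterate_succ_apply', Function.iterate_succ_apply']
    exact transition_mono hstep fun b hb => ih fun c hc => hfg c (hb.trans hc)

lemma iterate_transition_le_pow_mul {f : σ → ℝ} {ρ : ℝ} {a : σ} (hstep : ∀ a b, a ≤ step a b)
    (hρ : 0 ≤ ρ) (hf : ∀ b, a ≤ b → transition ν step f b ≤ ρ * f b) (t : ℕ) :
    (transition ν step)^[t] f a ≤ ρ ^ t * f a := by
  induction t generalizing a with
  | zero => simp
  | succ t ih =>
    rw [Function.iterate_succ_apply']
    calc transition ν step ((transition ν step)^[t] f) a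
        ≤ transition ν step (fun b => ρ ^ t * f b) a :=
          transition_mono hstep fun b hb => ih fun c hc => hf c (hb.trans hc)
      _ = ρ ^ t * transition ν step f a := by rw [transition_const_mul]
      _ ≤ ρ ^ t * (ρ * f a) := by gcongr; exact hf a le_rfl
      _ = ρ ^ (t + 1) * f a := by ring

lemma failProb_add_le {A B : Set σ} {s t : ℕ} {a : σ} {x y : ℝ} (hstep : ∀ a b, a ≤ step a b)
    (hy : 0 ≤ y) (hA : failProb ν step A s a ≤ x) (hB : ∀ b ∈ A, failProb ν step B t b ≤ y) :
    failProb ν step B (s + t) a ≤ x + y := by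
  have hpoint : ∀ b, failProb ν step B t b ≤ y + Aᶜ.indicator 1 b := fun b => by
    by_cases hb : b ∈ A
    · simpa [hb] using hB b hb
    · simpa [hb] using (failProb_le_one B t b).trans (le_add_of_nonneg_left hy)
  calc failProb ν step B (s + t) a = (transition ν step)^[s] (failProb ν step B t) a := by
        rw [failProb, Function.iterate_add_apply]; rfl
    _ ≤ (transition ν step)^[s] (fun b => y + Aᶜ.indicator 1 b) a :=
        iterate_transition_mono hstep (fun b _ => hpoint b) s
    _ = y + failProb ν step A s a := by rw [iterate_transition_const_add]; rfl
    _ ≤ x + y := by linarith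

lemma transition_indicator_compl_le {A : Set σ} {f : σ → ℝ} {ρ : ℝ} {a : σ}
    (hstep : ∀ a b, a ≤ step a b) (hA : IsUpperSet A) (hf₀ : ∀ b, 0 ≤ f b)
    (hf : a ∉ A → transition ν step f a ≤ ρ * f a) :
    transition ν step (Aᶜ.indicator f) a ≤ ρ * Aᶜ.indicator f a := by
  by_cases ha : a ∈ A
  · simp [transition, ha, hA (hstep a _) ha]
  · calc transition ν step (Aᶜ.indicator f) a ≤ transition ν step f a :=
          transition_mono hstep fun b _ => Set.indicator_le_self' (fun _ _ => hf₀ _) b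
      _ ≤ ρ * Aᶜ.indicator f a := by simpa [ha] using hf ha

-- Markov's inequality for the function `f`, stopped when the chain enters `A`.
lemma failProb_le_of_transition_le {A : Set σ} {f : σ → ℝ} {ρ x : ℝ} {a : σ}
    (hstep : ∀ a b, a ≤ step a b) (hA : IsUpperSet A) (hρ : 0 ≤ ρ) (hx : 0 ≤ x)
    (hf₀ : ∀ b, 0 ≤ f b) (hone : ∀ b, a ≤ b → b ∉ A → 1 ≤ x * f b)
    (hf : ∀ b, a ≤ b → b ∉ A → transition ν step f b ≤ ρ * f b) (t : ℕ) :
    failProb ν step A t a ≤ x * (ρ ^ t * f a) :=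
  calc failProb ν step A t a ≤ (transition ν step)^[t] (fun b => x * Aᶜ.indicator f b) a :=
        iterate_transition_mono hstep (fun b hb => by
          by_cases hbA : b ∈ A
          · simp [hbA]
          · simpa [hbA] using hone b hb hbA) t
    _ = x * (transition ν step)^[t] (Aᶜ.indicator f) a := by rw [iterate_transition_const_mul]
    _ ≤ x * (ρ ^ t * Aᶜ.indicator f a) := by
        gcongr
        exact iterate_transition_le_pow_mul hstep hρ
          (fun b hb => transition_indicator_compl_le hstep hA hf₀ (hf b hb)) t
    _ ≤ x * (ρ ^ t * f a) := by
        gcongr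
        exact Set.indicator_le_self' (fun _ _ => hf₀ _) a

lemma integral_infinitePi_restrict_range_eval (t : ℕ)
    (F : (Finset.range t → β) → β → ℝ) :
    ∫ ω, F ((Finset.range t).restrict ω) (ω t) ∂Measure.infinitePi (fun _ : ℕ => ν) =
      ∫ ω, ∫ b, F ((Finset.range t).restrict ω) b ∂ν ∂Measure.infinitePi (fun _ : ℕ => ν) := by
  have hrestrict : Measurable ((Finset.range t).restrict : (ℕ → β) → _) :=
    Finset.measurable_restrict _
  have heval : Measurable fun ω : ℕ → β => ω t := measurable_pi_apply t
  have hindep : ProbabilityTheory.IndepFun (Finset.range t).restrict (fun ω : ℕ → β => ω t)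
      (Measure.infinitePi fun _ : ℕ => ν) :=
    ((ProbabilityTheory.iIndepFun_infinitePi (P := fun _ : ℕ => ν) (X := fun _ b => b)
      fun _ => measurable_id).indepFun_finset (Finset.range t) {t} (by simp)
        fun i => measurable_pi_apply i).comp (φ := id)
          (ψ := fun x : ({t} : Finset ℕ) → β => x ⟨t, by simp⟩) measurable_id
          (measurable_pi_apply _)
  have hprod := (ProbabilityTheory.indepFun_iff_map_prod_eq_prod_map_map
    hrestrict.aemeasurable heval.aemeasurable).1 hindep
  rw [Measure.infinitePi_map_eval _ t] at hprod
  have := Measure.isProbabilityMeasure_map (μ := Measure.infinitePi fun _ : ℕ => ν)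
    hrestrict.aemeasurable
  calc ∫ ω, F ((Finset.range t).restrict ω) (ω t) ∂Measure.infinitePi (fun _ : ℕ => ν)
      = ∫ p, F p.1 p.2 ∂(Measure.infinitePi fun _ : ℕ => ν).map
          fun ω => ((Finset.range t).restrict ω, ω t) :=
        (integral_map (f := fun p => F p.1 p.2) (hrestrict.prodMk heval).aemeasurable
          (measurable_of_finite _).aestronglyMeasurable).symm
    _ = _ := by
        rw [hprod, integral_prod _ .of_finite,
          integral_map hrestrict.aemeasurable (measurable_of_finite _).aestronglyMeasurable]

end Finite

end RandomIteration

section Informed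

variable {n : ℕ} {step : Finset (Fin n) → Calls n → Finset (Fin n)} {v : Fin n}

lemma informed_congr {ω ω' : ℕ → Calls n} {t : ℕ} (h : ∀ i < t, ω i = ω' i) :
    informed step v ω t = informed step v ω' t := by
  induction t with
  | zero => rfl
  | succ t ih =>
    rw [informed, informed, ih fun i hi => h i (hi.trans t.lt_succ_self), h t t.lt_succ_self]

lemma exists_informed_eq_comp_restrict (step : Finset (Fin n) → Calls n → Finset (Fin n))
    (v : Fin n) (t : ℕ) : ∃ R : (Finset.range t → Calls n) → Finset (Fin n),
      ∀ ω, informed step v ω t = R ((Finset.range t).restrict ω) := by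
  refine ⟨fun x => informed step v
    (fun i => if h : i ∈ Finset.range t then x ⟨i, h⟩ else fun u => (u, false)) t, fun ω => ?_⟩
  exact informed_congr fun i hi => by simp [hi]

lemma monotone_informed (hstep : ∀ I c, I ≤ step I c) (ω : ℕ → Calls n) :
    Monotone (informed step v ω) :=
  monotone_nat_of_le_succ fun _ => hstep _ _

lemma measurableSet_informed_mem (t : ℕ) (A : Set (Finset (Fin n))) :
    MeasurableSet {ω : ℕ → Calls n | informed step v ω t ∈ A} := by
  obtain ⟨R, hR⟩ := exists_informed_eq_comp_restrict step v t
  simp only [hR]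
  exact (Set.toFinite (R ⁻¹' A)).measurableSet.preimage (Finset.measurable_restrict _)

lemma integral_informed (ν : Measure (Calls n)) [IsProbabilityMeasure ν] (t : ℕ)
    (f : Finset (Fin n) → ℝ) :
    ∫ ω, f (informed step v ω t) ∂Measure.infinitePi (fun _ => ν) =
      (transition ν step)^[t] f {v} := by
  induction t generalizing f with
  | zero => simp [informed]
  | succ t ih =>
    obtain ⟨R, hR⟩ := exists_informed_eq_comp_restrict step v t
    rw [Function.iterate_succ_apply, ← ih]
    simp only [informed, hR]
    exact integral_infinitePi_restrict_range_eval t fun x c => f (step (R x) c)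

lemma measureReal_informed_notMem (ν : Measure (Calls n)) [IsProbabilityMeasure ν] (t : ℕ)
    (A : Set (Finset (Fin n))) :
    (Measure.infinitePi fun _ => ν).real {ω | informed step v ω t ∉ A} =
      failProb ν step A t {v} := by
  rw [failProb, ← integral_informed, ← integral_indicator_one]
  · rfl
  · exact measurableSet_informed_mem t Aᶜ

end Informed

section SecondMoment

variable {Ω : Type*} [MeasurableSpace Ω] {μ : Measure Ω}

lemma inv_add_le_quadratic {x m z : ℝ} (hx : 0 < x) (hm : 0 ≤ m) (hz : 0 ≤ z) :
    (x + z)⁻¹ ≤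
      (x + m)⁻¹ - (z - m) * (x + m)⁻¹ ^ 2 + (z - m) ^ 2 * ((x + m)⁻¹ ^ 2 * x⁻¹) := by
  have hexact : (x + z)⁻¹ =
      (x + m)⁻¹ - (z - m) * (x + m)⁻¹ ^ 2 + (z - m) ^ 2 * ((x + m)⁻¹ ^ 2 * (x + z)⁻¹) := by
    field_simp
    ring
  have hinv : (x + z)⁻¹ ≤ x⁻¹ := inv_anti₀ hx (by linarith)
  calc (x + z)⁻¹ = _ := hexact
    _ ≤ _ := by gcongr

lemma integral_inv_add_le [IsProbabilityMeasure μ] {Z : Ω → ℝ} {x b : ℝ} (hx : 0 < x)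
    (hZ₀ : ∀ ω, 0 ≤ Z ω) (hZ : Integrable Z μ) (hZ2 : Integrable (fun ω => Z ω ^ 2) μ)
    (hsq : ∫ ω, Z ω ^ 2 ∂μ ≤ b * ∫ ω, Z ω ∂μ + (∫ ω, Z ω ∂μ) ^ 2) :
    ∫ ω, (x + Z ω)⁻¹ ∂μ ≤ (x / (x + ∫ ω, Z ω ∂μ) +
      b * (∫ ω, Z ω ∂μ) / (x + ∫ ω, Z ω ∂μ) ^ 2) * x⁻¹ := by
  have hm : 0 ≤ ∫ ω, Z ω ∂μ := integral_nonneg hZ₀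
  set m := ∫ ω, Z ω ∂μ
  have hquad : ∀ ω, (x + Z ω)⁻¹ ≤
      ((x + m)⁻¹ + (m * (x + m)⁻¹ ^ 2 + m ^ 2 * ((x + m)⁻¹ ^ 2 * x⁻¹))) +
      (-((x + m)⁻¹ ^ 2) - 2 * m * ((x + m)⁻¹ ^ 2 * x⁻¹)) * Z ω +
      ((x + m)⁻¹ ^ 2 * x⁻¹) * Z ω ^ 2 := fun ω => by
    linarith [inv_add_le_quadratic hx hm (hZ₀ ω)]
  have hlin : ∀ r s : ℝ, Integrable (fun ω => r + s * Z ω) μ := fun r s =>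
    (integrable_const r).add (hZ.const_mul s)
  refine (integral_mono_of_nonneg
    (.of_forall fun ω => inv_nonneg.2 (add_nonneg hx.le (hZ₀ ω)))
    ((hlin _ _).add (hZ2.const_mul _)) (.of_forall hquad)).trans ?_
  rw [integral_add' (hlin _ _) (hZ2.const_mul _), integral_add (integrable_const _)
    (hZ.const_mul _), integral_const_mul, integral_const_mul, integral_const, probReal_univ,
    one_smul]
  calc _ = ((x + m)⁻¹ - m ^ 2 * ((x + m)⁻¹ ^ 2 * x⁻¹)) +
          ((x + m)⁻¹ ^ 2 * x⁻¹) * ∫ ω, Z ω ^ 2 ∂μ := by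
        ring
    _ ≤ ((x + m)⁻¹ - m ^ 2 * ((x + m)⁻¹ ^ 2 * x⁻¹)) +
          ((x + m)⁻¹ ^ 2 * x⁻¹) * (b * m + m ^ 2) := by gcongr
    _ = (x / (x + m) + b * m / (x + m) ^ 2) * x⁻¹ := by field_simp; ring

lemma integral_sum_indicator_const [IsFiniteMeasure μ] {ι : Type*} {s : Finset ι}
    {E : ι → Set Ω} {φ : ι → ℝ} (hE : ∀ i ∈ s, MeasurableSet (E i)) :
    ∫ ω, ∑ i ∈ s, (E i).indicator (fun _ => φ i) ω ∂μ = ∑ i ∈ s, φ i * μ.real (E i) := by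
  rw [integral_finsetSum _ fun i hi => (integrable_const _).indicator (hE i hi)]
  refine Finset.sum_congr rfl fun i hi => ?_
  rw [integral_indicator_const _ (hE i hi), smul_eq_mul, mul_comm]

lemma integral_sq_sum_indicator_le [IsFiniteMeasure μ] {ι : Type*} {s : Finset ι}
    {E : ι → Set Ω} {φ : ι → ℝ} {b : ℝ} (hE : ∀ i ∈ s, MeasurableSet (E i))
    (hcorr : ∀ i ∈ s, ∀ j ∈ s, i ≠ j → μ.real (E i ∩ E j) ≤ μ.real (E i) * μ.real (E j))
    (hφ₀ : ∀ i, 0 ≤ φ i) (hφb : ∀ i, φ i ≤ b) :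
    ∫ ω, (∑ i ∈ s, (E i).indicator (fun _ => φ i) ω) ^ 2 ∂μ ≤
      b * ∑ i ∈ s, φ i * μ.real (E i) + (∑ i ∈ s, φ i * μ.real (E i)) ^ 2 := by
  classical
  have hexpand : ∀ ω, (∑ i ∈ s, (E i).indicator (fun _ => φ i) ω) ^ 2 =
      ∑ p ∈ s ×ˢ s, (E p.1 ∩ E p.2).indicator (fun _ => φ p.1 * φ p.2) ω := fun ω => by
    simp only [sq, Finset.sum_mul_sum, Finset.sum_product, Set.inter_indicator_mul]
  have hpair : ∀ i ∈ s, ∀ j ∈ s, φ i * φ j * μ.real (E i ∩ E j) ≤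
      (if i = j then b * (φ i * μ.real (E i)) else 0) +
        (φ i * μ.real (E i)) * (φ j * μ.real (E j)) := by
    intro i hi j hj
    split_ifs with hij
    · subst hij
      have hterm : 0 ≤ φ i * μ.real (E i) := mul_nonneg (hφ₀ i) measureReal_nonneg
      rw [Set.inter_self]
      nlinarith [hφb i, mul_nonneg hterm hterm]
    · nlinarith [mul_le_mul_of_nonneg_left (hcorr i hi j hj hij) (mul_nonneg (hφ₀ i) (hφ₀ j))]
  simp only [hexpand]
  rw [integral_sum_indicator_const fun p hp => (hE _ (Finset.mem_product.1 hp).1).inter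
    (hE _ (Finset.mem_product.1 hp).2), Finset.sum_product]
  calc ∑ i ∈ s, ∑ j ∈ s, φ i * φ j * μ.real (E i ∩ E j)
      ≤ ∑ i ∈ s, ∑ j ∈ s, ((if i = j then b * (φ i * μ.real (E i)) else 0) +
        (φ i * μ.real (E i)) * (φ j * μ.real (E j))) :=
        Finset.sum_le_sum fun i hi => Finset.sum_le_sum fun j hj => hpair i hi j hj
    _ = b * ∑ i ∈ s, φ i * μ.real (E i) + (∑ i ∈ s, φ i * μ.real (E i)) ^ 2 := by
        rw [Finset.mul_sum, sq, Finset.sum_mul_sum]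
        simp [Finset.sum_add_distrib]

lemma measureReal_inter_le_mul_of_compl [IsProbabilityMeasure μ] {A B : Set Ω}
    (hA : MeasurableSet A) (hB : MeasurableSet B)
    (h : μ.real (Aᶜ ∩ Bᶜ) ≤ μ.real Aᶜ * μ.real Bᶜ) : μ.real (A ∩ B) ≤ μ.real A * μ.real B := by
  rw [← Set.compl_union, probReal_compl_eq_one_sub (hA.union hB), probReal_compl_eq_one_sub hA,
    probReal_compl_eq_one_sub hB] at h
  linarith [measureReal_union_add_inter (μ := μ) (s := A) hB]

lemma measureReal_compl_inter_compl_le_mul [IsProbabilityMeasure μ] {A B : Set Ω}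
    (hA : MeasurableSet A) (hB : MeasurableSet B) (hAB : Disjoint A B) :
    μ.real (Aᶜ ∩ Bᶜ) ≤ μ.real Aᶜ * μ.real Bᶜ := by
  rw [← Set.compl_union, probReal_compl_eq_one_sub (hA.union hB), probReal_compl_eq_one_sub hA,
    probReal_compl_eq_one_sub hB, measureReal_union hAB hB]
  have : 0 ≤ μ.real A * μ.real B := by positivity
  linarith

end SecondMoment

section Round

/-- One round of push (`pull = false`) or of push&pull (`pull = true`), so that both protocols
can be treated simultaneously. -/
def protocolStep {n : ℕ} (pull : Bool) (I : Finset (Fin n)) (c : Calls n) : Finset (Fin n) :=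
  I ∪ Finset.univ.filter fun w =>
    (∃ u ∈ I, c u = (w, true)) ∨ (pull = true ∧ ∃ u ∈ I, c w = (u, true))

lemma pushStep_eq_protocolStep {n : ℕ} :
    (pushStep : Finset (Fin n) → Calls n → _) = protocolStep false := by
  funext I c
  simp [pushStep, protocolStep]

lemma pushPullStep_eq_protocolStep {n : ℕ} :
    (pushPullStep : Finset (Fin n) → Calls n → _) = protocolStep true := by
  funext I c
  simp [pushPullStep, protocolStep]

lemma le_protocolStep {n : ℕ} (pull : Bool) (I : Finset (Fin n)) (c : Calls n) :
    I ≤ protocolStep pull I c :=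
  Finset.subset_union_left

variable {n : ℕ} (G : SimpleGraph (Fin n)) [DecidableRel G.Adj] (q : unitInterval)

/-- The law of the call of the vertex `v` in one round: the called vertex and whether the
transmission succeeds. -/
noncomputable def callLaw (v : Fin n) : Measure (Fin n × Bool) :=
  (contactLaw G v).toMeasure.prod (ProbabilityTheory.bernoulliMeasure true false q)

instance (v : Fin n) : IsProbabilityMeasure (callLaw G q v) := by
  unfold callLaw
  infer_instance

lemma roundLaw_real_pi (B : Fin n → Set (Fin n × Bool)) :
    (roundLaw G q).real (Set.pi Set.univ B) = ∏ v, (callLaw G q v).real (B v) := by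
  rw [roundLaw, measureReal_def, Measure.pi_pi, ENNReal.toReal_prod]
  rfl

/-- The probability that `u` successfully calls `w` in one round. -/
noncomputable def callProb (u w : Fin n) : ℝ := (callLaw G q u).real {(w, true)}

/-- The expected number of calls that would inform the uninformed vertex `w` in one round, if `I`
is the set of informed vertices. -/
noncomputable def contactRate (pull : Bool) (I : Finset (Fin n)) (w : Fin n) : ℝ :=
  ∑ u ∈ I, callProb G q u w + if pull = true then ∑ u ∈ I, callProb G q w u else 0

/-- The probability that `w` is informed after a round started from the informed set `I`. -/
noncomputable def informProb (pull : Bool) (I : Finset (Fin n)) (w : Fin n) : ℝ :=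
  (roundLaw G q).real {c | w ∈ protocolStep pull I c}

/-- The expected total weight `φ` of the vertices that are newly informed in one round started from
the informed set `I`. -/
noncomputable def expectedGain (pull : Bool) (φ : Fin n → ℝ) (I : Finset (Fin n)) : ℝ :=
  ∑ w ∈ Iᶜ, φ w * informProb G q pull I w

/-- The calls of `v` that do not inform the uninformed vertex `w`, if `I` is the set of informed
vertices. -/
def missing (pull : Bool) (I : Finset (Fin n)) (w v : Fin n) : Set (Fin n × Bool) :=
  if v ∈ I then {(w, true)}ᶜ
  else if v = w ∧ pull = true then {x | x.1 ∈ I ∧ x.2 = true}ᶜ else Set.univ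

variable {G q} {pull : Bool} {φ : Fin n → ℝ} {I : Finset (Fin n)} {w : Fin n}

lemma callProb_nonneg (u w : Fin n) : 0 ≤ callProb G q u w := measureReal_nonneg

lemma callProb_eq {u : Fin n} (hu : 0 < G.degree u) (w : Fin n) :
    callProb G q u w = if G.Adj u w then (q : ℝ) / G.degree u else 0 := by
  have hne : (G.neighborFinset u).Nonempty := Finset.card_pos.1 hu
  have hsuccess : (ProbabilityTheory.bernoulliMeasure true false q).real {true} = q := by
    rw [ProbabilityTheory.bernoulliMeasure_real_apply] <;> simp
  rw [callProb, callLaw, ← Set.singleton_prod_singleton, measureReal_prod_prod, hsuccess,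
    measureReal_def, PMF.toMeasure_apply_singleton _ _ (measurableSet_singleton _), contactLaw,
    dif_pos hne, PMF.uniformOfFinset_apply]
  simp only [SimpleGraph.mem_neighborFinset, SimpleGraph.card_neighborFinset_eq_degree]
  split_ifs
  · simp [div_eq_inv_mul]
  · simp

lemma sum_callProb_eq_measureReal (u : Fin n) (S : Finset (Fin n)) :
    ∑ w ∈ S, callProb G q u w = (callLaw G q u).real {x | x.1 ∈ S ∧ x.2 = true} := by
  have hprod : {x : Fin n × Bool | x.1 ∈ S ∧ x.2 = true} = ↑(S ×ˢ ({true} : Finset Bool)) := by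
    ext
    simp only [Finset.mem_coe, Finset.mem_product, Finset.mem_singleton, Set.mem_ofPred_eq]
  rw [hprod, ← sum_measureReal_singleton, Finset.sum_product]
  simp [callProb]

lemma contactRate_false (I : Finset (Fin n)) (w : Fin n) :
    contactRate G q false I w = ∑ u ∈ I, callProb G q u w := by
  simp [contactRate]

lemma contactRate_true (I : Finset (Fin n)) (w : Fin n) :
    contactRate G q true I w = ∑ u ∈ I, callProb G q u w + ∑ u ∈ I, callProb G q w u := by
  simp [contactRate]

lemma contactRate_false_le (pull : Bool) (I : Finset (Fin n)) (w : Fin n) :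
    contactRate G q false I w ≤ contactRate G q pull I w := by
  cases pull
  · rfl
  · rw [contactRate_false, contactRate_true]
    exact le_add_of_nonneg_right (Finset.sum_nonneg fun u _ => callProb_nonneg w u)

lemma contactRate_nonneg (pull : Bool) (I : Finset (Fin n)) (w : Fin n) :
    0 ≤ contactRate G q pull I w := by
  refine le_trans ?_ (contactRate_false_le pull I w)
  rw [contactRate_false]
  exact Finset.sum_nonneg fun u _ => callProb_nonneg u w

lemma setOf_notMem_protocolStep (hw : w ∉ I) :
    {c : Calls n | w ∈ protocolStep pull I c}ᶜ = Set.pi Set.univ (missing pull I w) := by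
  ext c
  simp only [protocolStep, Finset.mem_union, hw, false_or, Finset.mem_filter_univ, not_or,
    Set.mem_compl_iff, Set.mem_ofPred_eq, Set.mem_univ_pi, missing]
  constructor
  · rintro ⟨hpush, hpull⟩ v
    split_ifs with hv hvw
    · exact fun h => hpush ⟨v, hv, h⟩
    · rintro ⟨hcalled, hsuccess⟩
      obtain ⟨rfl, hp⟩ := hvw
      exact hpull ⟨hp, (c v).1, hcalled, Prod.ext rfl hsuccess⟩
    · trivial
  · refine fun h => ⟨?_, ?_⟩
    · rintro ⟨u, hu, hc⟩
      simpa [hu, hc] using h u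
    · rintro ⟨hp, u, hu, hc⟩
      simpa [hw, hp, hc, hu] using h w

lemma measureReal_compl_informed (hw : w ∉ I) :
    (roundLaw G q).real {c | w ∈ protocolStep pull I c}ᶜ =
      ∏ v, (callLaw G q v).real (missing pull I w v) := by
  rw [setOf_notMem_protocolStep hw, roundLaw_real_pi]

lemma callLaw_real_missing (hw : w ∉ I) (v : Fin n) :
    (callLaw G q v).real (missing pull I w v) = 1 - ((if v ∈ I then callProb G q v w else 0) +
      if v = w then if pull = true then ∑ u ∈ I, callProb G q w u else 0 else 0) := by
  by_cases hv : v ∈ I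
  · have hvw : v ≠ w := fun h => hw (h ▸ hv)
    simp only [missing, hv, if_true, hvw, if_false, add_zero, callProb]
    exact probReal_compl_eq_one_sub (measurableSet_singleton _)
  · by_cases hvw : v = w <;> cases pull <;>
      simp [missing, hv, hvw, hw, sum_callProb_eq_measureReal,
        probReal_compl_eq_one_sub (Set.toFinite _).measurableSet]

lemma one_sub_informProb_le_exp (hw : w ∉ I) :
    1 - informProb G q pull I w ≤ Real.exp (-contactRate G q pull I w) := by
  have hrate : contactRate G q pull I w = ∑ v, ((if v ∈ I then callProb G q v w else 0) +
      if v = w then if pull = true then ∑ u ∈ I, callProb G q w u else 0 else 0) := by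
    simp [contactRate, Finset.sum_add_distrib]
  rw [informProb, ← probReal_compl_eq_one_sub (Set.toFinite _).measurableSet,
    measureReal_compl_informed hw, hrate, ← Finset.sum_neg_distrib, Real.exp_sum]
  refine Finset.prod_le_prod (fun _ _ => measureReal_nonneg) fun v _ => ?_
  rw [callLaw_real_missing hw]
  exact Real.one_sub_le_exp_neg _

lemma contactRate_div_one_add_le_informProb (hw : w ∉ I) :
    contactRate G q pull I w / (1 + contactRate G q pull I w) ≤ informProb G q pull I w := by
  have hs := contactRate_nonneg (G := G) (q := q) pull I w
  have hexp := one_sub_informProb_le_exp (G := G) (q := q) (pull := pull) hw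
  set s := contactRate G q pull I w
  have hinv : Real.exp (-s) ≤ (1 + s)⁻¹ := by
    rw [Real.exp_neg]
    exact inv_anti₀ (by linarith) (by linarith [Real.add_one_le_exp s])
  calc s / (1 + s) = 1 - (1 + s)⁻¹ := by field_simp; ring
    _ ≤ informProb G q pull I w := by linarith

lemma informProb_false_le (hw : w ∉ I) :
    informProb G q false I w ≤ contactRate G q false I w := by
  have hsubset : {c : Calls n | w ∈ protocolStep false I c} ⊆
      ⋃ u ∈ I, {c : Calls n | c u = (w, true)} := fun c hc => by
    simpa [protocolStep, hw] using hc
  rw [contactRate_false]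
  calc informProb G q false I w
      ≤ ∑ u ∈ I, (roundLaw G q).real {c : Calls n | c u = (w, true)} :=
        (measureReal_mono hsubset (measure_ne_top _ _)).trans (measureReal_biUnion_finset_le _ _)
    _ = ∑ u ∈ I, callProb G q u w := Finset.sum_congr rfl fun u _ =>
        (measurePreserving_eval (fun v => callLaw G q v) u).measureReal_preimage
          (measurableSet_singleton (w, true)).nullMeasurableSet

-- A call informs at most one uninformed vertex, which makes these events negatively correlated.
lemma measureReal_inter_informed_le {w' : Fin n} (hw : w ∉ I) (hw' : w' ∉ I) (hne : w ≠ w') :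
    (roundLaw G q).real ({c | w ∈ protocolStep pull I c} ∩ {c | w' ∈ protocolStep pull I c}) ≤
      informProb G q pull I w * informProb G q pull I w' := by
  refine measureReal_inter_le_mul_of_compl (Set.toFinite _).measurableSet
    (Set.toFinite _).measurableSet ?_
  rw [measureReal_compl_informed hw, measureReal_compl_informed hw', setOf_notMem_protocolStep hw,
    setOf_notMem_protocolStep hw', ← Set.pi_inter_distrib, roundLaw_real_pi,
    ← Finset.prod_mul_distrib]
  refine Finset.prod_le_prod (fun _ _ => measureReal_nonneg) fun v _ => ?_
  by_cases hv : v ∈ I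
  · simp only [missing, hv, if_true]
    exact measureReal_compl_inter_compl_le_mul (measurableSet_singleton _)
      (measurableSet_singleton _) (by simpa using hne)
  · by_cases hvw : v = w
    · have hvw' : v ≠ w' := fun h => hne (hvw.symm.trans h)
      simp [missing, hv, hvw']
    · simp [missing, hv, hvw]

lemma sum_protocolStep (φ : Fin n → ℝ) (c : Calls n) :
    ∑ w ∈ protocolStep pull I c, φ w =
      ∑ w ∈ I, φ w + ∑ w ∈ Iᶜ, {c | w ∈ protocolStep pull I c}.indicator (fun _ => φ w) c := by
  classical
  have hnew : protocolStep pull I c \ I = Iᶜ.filter (· ∈ protocolStep pull I c) := by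
    ext
    simp [and_comm]
  rw [← Finset.sum_sdiff (le_protocolStep pull I c), add_comm, hnew, Finset.sum_filter]
  simp [Set.indicator]

lemma transition_sum :
    transition (roundLaw G q) (protocolStep pull) (fun J => ∑ w ∈ J, φ w) I =
      ∑ w ∈ I, φ w + expectedGain G q pull φ I := by
  simp only [transition, sum_protocolStep]
  rw [integral_add .of_finite .of_finite,
    integral_sum_indicator_const fun _ _ => (Set.toFinite _).measurableSet]
  simp [expectedGain, informProb]

-- Negative correlation bounds the second moment of the gain, so that the reciprocal of the weight
-- contracts in expectation almost as if the gain were deterministic.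
lemma transition_inv_sum_le {b : ℝ} (hφ₀ : ∀ w, 0 ≤ φ w) (hφb : ∀ w, φ w ≤ b)
    (hI : 0 < ∑ w ∈ I, φ w) :
    transition (roundLaw G q) (protocolStep pull) (fun J => (∑ w ∈ J, φ w)⁻¹) I ≤
      ((∑ w ∈ I, φ w) / (∑ w ∈ I, φ w + expectedGain G q pull φ I) +
        b * expectedGain G q pull φ I / (∑ w ∈ I, φ w + expectedGain G q pull φ I) ^ 2) *
        (∑ w ∈ I, φ w)⁻¹ := by
  have hgain : ∫ c, ∑ w ∈ Iᶜ, {c | w ∈ protocolStep pull I c}.indicator (fun _ => φ w) c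
      ∂roundLaw G q = expectedGain G q pull φ I :=
    integral_sum_indicator_const fun _ _ => (Set.toFinite _).measurableSet
  simp only [transition, sum_protocolStep]
  rw [← hgain]
  refine integral_inv_add_le hI (fun c => Finset.sum_nonneg fun w _ =>
    Set.indicator_nonneg (fun _ _ => hφ₀ w) c) .of_finite .of_finite ?_
  rw [hgain]
  exact integral_sq_sum_indicator_le (fun _ _ => (Set.toFinite _).measurableSet)
    (fun w hw w' hw' => measureReal_inter_informed_le (Finset.mem_compl.1 hw)
      (Finset.mem_compl.1 hw')) hφ₀ hφb

end Round

section Phases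

/-- The vertex sets with at least `m` elements. -/
def largeSets (n : ℕ) (m : ℝ) : Set (Finset (Fin n)) := {J | m ≤ (J.card : ℝ)}

lemma mem_largeSets {n : ℕ} {m : ℝ} {J : Finset (Fin n)} :
    J ∈ largeSets n m ↔ m ≤ (J.card : ℝ) :=
  Iff.rfl

lemma notMem_largeSets {n : ℕ} {m : ℝ} {J : Finset (Fin n)} :
    J ∉ largeSets n m ↔ (J.card : ℝ) < m := by
  rw [mem_largeSets, not_le]

lemma isUpperSet_largeSets (n : ℕ) (m : ℝ) : IsUpperSet (largeSets n m) := fun _ _ hJK hJ =>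
  le_trans (mem_largeSets.1 hJ) (by exact_mod_cast Finset.card_le_card hJK)

lemma cast_card_compl {n : ℕ} (J : Finset (Fin n)) : (Jᶜ.card : ℝ) = n - J.card := by
  rw [Finset.card_compl, Fintype.card_fin, Nat.cast_sub]
  simpa using Finset.card_le_univ J

variable {n : ℕ} (G : SimpleGraph (Fin n)) [DecidableRel G.Adj] (q : unitInterval) (pull : Bool)

/-- In one round, an expected number of at least `c * min |J| |Jᶜ|` vertices is newly informed if
`J` is informed: the information crosses every cut. -/
def HasCutGain (c : ℝ) : Prop :=
  ∀ J : Finset (Fin n), c * min (J.card : ℝ) (Jᶜ.card : ℝ) ≤ expectedGain G q pull (fun _ => 1) J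

/-- In one round, the expected `φ`-weight of an informed set with at most `m` vertices grows by a
factor of at least `1 + γ`. -/
def HasGrowth (φ : Fin n → ℝ) (γ m : ℝ) : Prop :=
  ∀ J : Finset (Fin n), (J.card : ℝ) ≤ m → γ * ∑ w ∈ J, φ w ≤ expectedGain G q pull φ J

variable {G q pull}

lemma div_add_div_sq_le_one_sub_sq {c x g : ℝ} (hc : 0 < c) (hx : 1 ≤ x) (hg : c * x ≤ g) :
    x / (x + g) + g / (x + g) ^ 2 ≤ 1 - (c / (1 + c)) ^ 2 := by
  have hg₀ : 0 < g := lt_of_lt_of_le (by positivity) hg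
  have hratio : c / (1 + c) ≤ g / (x + g) := by
    rw [div_le_div_iff₀ (by linarith) (by linarith)]
    linarith
  have hbound : x / (x + g) + g / (x + g) ^ 2 ≤ 1 - (g / (x + g)) ^ 2 := by
    have hsplit : 1 - (g / (x + g)) ^ 2 - (x / (x + g) + g / (x + g) ^ 2) =
        g * (x - 1) / (x + g) ^ 2 := by
      field_simp
      ring
    have : 0 ≤ g * (x - 1) / (x + g) ^ 2 :=
      div_nonneg (mul_nonneg hg₀.le (sub_nonneg.2 hx)) (sq_nonneg _)
    linarith
  have hsq : (c / (1 + c)) ^ 2 ≤ (g / (x + g)) ^ 2 := by gcongr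
  linarith

lemma div_add_mul_div_sq_le {b γ x y g : ℝ} (hb : 0 ≤ b) (hγ : 0 < γ) (hy : 0 < y) (hyx : y ≤ x)
    (hg : γ * x ≤ g) : x / (x + g) + b * g / (x + g) ^ 2 ≤ (1 + γ)⁻¹ + b / y := by
  have hx : 0 < x := hy.trans_le hyx
  have hg₀ : 0 < g := lt_of_lt_of_le (by positivity) hg
  refine add_le_add ?_ ?_
  · rw [← one_div, div_le_div_iff₀ (by positivity) (by positivity)]
    linarith
  · have hsq : g * y ≤ (x + g) ^ 2 := by nlinarith [mul_le_mul_of_nonneg_left hyx hg₀.le]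
    rw [div_le_div_iff₀ (by positivity) hy]
    nlinarith [mul_le_mul_of_nonneg_left hsq hb]

lemma one_sub_sq_div_one_add_nonneg {c : ℝ} (hc : 0 < c) : 0 ≤ 1 - (c / (1 + c)) ^ 2 := by
  have : c / (1 + c) ≤ 1 := (div_le_one (by linarith)).2 (by linarith)
  nlinarith [show 0 ≤ c / (1 + c) by positivity]

lemma HasCutGain.failProb_largeSets_le {c m : ℝ} (hcut : HasCutGain G q pull c) (hc : 0 < c)
    (hm₀ : 0 ≤ m) (hm : m ≤ n / 2) {I : Finset (Fin n)} (hI : I.Nonempty) (t : ℕ) :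
    failProb (roundLaw G q) (protocolStep pull) (largeSets n m) t I ≤
      m * ((1 - (c / (1 + c)) ^ 2) ^ t * (I.card : ℝ)⁻¹) := by
  have hcard : ∀ J, I ≤ J → (1 : ℝ) ≤ J.card := fun J hIJ => by
    exact_mod_cast (hI.mono hIJ).card_pos
  refine failProb_le_of_transition_le (ν := roundLaw G q) (f := fun J => (J.card : ℝ)⁻¹)
    (le_protocolStep pull) (isUpperSet_largeSets n m) (one_sub_sq_div_one_add_nonneg hc) hm₀
    (fun J => by positivity) (fun J hIJ hJ => ?_) (fun J hIJ hJ => ?_) t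
  · rw [← div_eq_mul_inv, one_le_div (zero_lt_one.trans_le (hcard J hIJ))]
    exact (notMem_largeSets.1 hJ).le
  · have hgain := hcut J
    rw [min_eq_left (by rw [cast_card_compl]; linarith [notMem_largeSets.1 hJ])] at hgain
    have hinv := transition_inv_sum_le (G := G) (q := q) (pull := pull) (φ := fun _ => 1) (I := J)
      (b := 1) (fun _ => zero_le_one) (fun _ => le_rfl) (by simpa using hI.mono hIJ)
    simp only [Finset.sum_const, nsmul_eq_mul, mul_one, one_mul] at hinv
    refine hinv.trans ?_
    gcongr
    exact div_add_div_sq_le_one_sub_sq hc (hcard J hIJ) hgain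

lemma mul_card_le_sum {a : ℝ} {φ : Fin n → ℝ} (hφ : ∀ w, a ≤ φ w) (J : Finset (Fin n)) :
    a * J.card ≤ ∑ w ∈ J, φ w := by
  simpa [mul_comm] using Finset.card_nsmul_le_sum J φ a fun w _ => hφ w

lemma sum_le_mul_card {b : ℝ} {φ : Fin n → ℝ} (hφ : ∀ w, φ w ≤ b) (J : Finset (Fin n)) :
    ∑ w ∈ J, φ w ≤ b * J.card := by
  simpa [mul_comm] using Finset.sum_le_card_nsmul J φ b fun w _ => hφ w

lemma HasGrowth.failProb_largeSets_le {φ : Fin n → ℝ} {a b γ k m : ℝ}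
    (hgrow : HasGrowth G q pull φ γ m) (ha : 0 < a) (hγ : 0 < γ) (hk : 0 < k) (hm : 0 ≤ m)
    (hφa : ∀ w, a ≤ φ w) (hφb : ∀ w, φ w ≤ b) {I : Finset (Fin n)} (hI : k ≤ (I.card : ℝ))
    (t : ℕ) :
    failProb (roundLaw G q) (protocolStep pull) (largeSets n m) t I ≤
      b * m * (((1 + γ)⁻¹ + b / (a * k)) ^ t * (a * k)⁻¹) := by
  have hφ₀ : ∀ w, 0 ≤ φ w := fun w => ha.le.trans (hφa w)
  have hak : 0 < a * k := mul_pos ha hk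
  obtain ⟨w₀, -⟩ : I.Nonempty := Finset.card_pos.1 (by exact_mod_cast hk.trans_le hI)
  have hb : 0 ≤ b := (hφ₀ w₀).trans (hφb w₀)
  have hweight : ∀ J, I ≤ J → a * k ≤ ∑ w ∈ J, φ w := fun J hIJ =>
    calc a * k ≤ a * J.card := by
          gcongr
          exact hI.trans (by exact_mod_cast Finset.card_le_card hIJ)
      _ ≤ ∑ w ∈ J, φ w := mul_card_le_sum hφa J
  calc _ ≤ b * m * (((1 + γ)⁻¹ + b / (a * k)) ^ t * (∑ w ∈ I, φ w)⁻¹) := by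
        refine failProb_le_of_transition_le (ν := roundLaw G q) (f := fun J => (∑ w ∈ J, φ w)⁻¹)
          (le_protocolStep pull) (isUpperSet_largeSets n m) (by positivity) (by positivity)
          (fun J => inv_nonneg.2 (Finset.sum_nonneg fun w _ => hφ₀ w))
          (fun J hIJ hJ => ?_) (fun J hIJ hJ => ?_) t
        · rw [← div_eq_mul_inv, one_le_div (hak.trans_le (hweight J hIJ))]
          exact (sum_le_mul_card hφb J).trans (by gcongr; exact (notMem_largeSets.1 hJ).le)
        · have hpos := hak.trans_le (hweight J hIJ)
          refine (transition_inv_sum_le hφ₀ hφb hpos).trans ?_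
          gcongr ?_ * _
          exact div_add_mul_div_sq_le hb hγ hak (hweight J hIJ) (hgrow J (notMem_largeSets.1 hJ).le)
    _ ≤ _ := by
        gcongr _ * (_ * ?_⁻¹)
        exact hweight I le_rfl

lemma transition_card_compl (J : Finset (Fin n)) :
    transition (roundLaw G q) (protocolStep pull) (fun K => (Kᶜ.card : ℝ)) J =
      Jᶜ.card - expectedGain G q pull (fun _ => 1) J := by
  have haffine : (fun K : Finset (Fin n) => (Kᶜ.card : ℝ)) =
      fun K => n + -1 * ∑ _w ∈ K, (1 : ℝ) := by
    funext K
    simp [cast_card_compl, sub_eq_add_neg]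
  rw [haffine, transition_const_add, transition_const_mul]
  beta_reduce
  rw [transition_sum, cast_card_compl]
  simp only [Finset.sum_const, nsmul_eq_mul, mul_one]
  ring

lemma HasCutGain.failProb_almostAll_le {c : ℝ} (hcut : HasCutGain G q pull c) (hc : c ≤ 1)
    (hn : 0 < Real.log n) {I : Finset (Fin n)} (hI : (n : ℝ) / 2 ≤ (I.card : ℝ)) (t : ℕ) :
    failProb (roundLaw G q) (protocolStep pull) (largeSets n (n - n / Real.log n)) t I ≤
      Real.log n * (1 - c) ^ t := by
  have hn₀ : (0 : ℝ) < n := Nat.cast_pos.2 (Nat.pos_of_ne_zero (by rintro rfl; simp at hn))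
  have : 0 ≤ (1 - c) ^ t := pow_nonneg (by linarith) t
  calc _ ≤ Real.log n / n * ((1 - c) ^ t * (Iᶜ.card : ℝ)) := by
        refine failProb_le_of_transition_le (ν := roundLaw G q) (f := fun J => (Jᶜ.card : ℝ))
          (le_protocolStep pull) (isUpperSet_largeSets n _) (sub_nonneg.2 hc)
          (div_pos hn hn₀).le (fun J => Nat.cast_nonneg _) (fun J _ hJ => ?_)
          (fun J hIJ _ => ?_) t
        · calc (1 : ℝ) = Real.log n / n * (n / Real.log n) := by field_simp
            _ ≤ Real.log n / n * (Jᶜ.card : ℝ) := by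
                gcongr
                rw [cast_card_compl]
                linarith [notMem_largeSets.1 hJ]
        · have hIJ' : (I.card : ℝ) ≤ J.card := by exact_mod_cast Finset.card_le_card hIJ
          have hgain := hcut J
          rw [min_eq_right (by rw [cast_card_compl]; linarith)] at hgain
          rw [transition_card_compl]
          linarith
    _ ≤ Real.log n / n * ((1 - c) ^ t * n) := by
        gcongr
        simpa using Finset.card_le_univ Iᶜ
    _ = Real.log n * (1 - c) ^ t := by field_simp

lemma failProb_almostAll_le_of_hasCutGain_of_hasGrowth {φ : Fin n → ℝ} {a b c γ k m : ℝ}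
    (hcut : HasCutGain G q pull c) (hgrow : HasGrowth G q pull φ γ m) (hc₀ : 0 < c) (hc₁ : c ≤ 1)
    (ha : 0 < a) (hb : 0 < b) (hγ : 0 < γ) (hk : 0 < k) (hkn : k ≤ n / 2) (hm : 0 < m)
    (hn : 0 < Real.log n) (hφa : ∀ w, a ≤ φ w) (hφb : ∀ w, φ w ≤ b) (t₀ t₁ t₂ t₃ : ℕ)
    (v : Fin n) :
    failProb (roundLaw G q) (protocolStep pull) (largeSets n (n - n / Real.log n))
        (t₀ + (t₁ + (t₂ + t₃))) {v} ≤
      k * (1 - (c / (1 + c)) ^ 2) ^ t₀ +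
        (b * m * (((1 + γ)⁻¹ + b / (a * k)) ^ t₁ * (a * k)⁻¹) +
          (n / 2 * ((1 - (c / (1 + c)) ^ 2) ^ t₂ * m⁻¹) + Real.log n * (1 - c) ^ t₃)) := by
  have hρ₀ := one_sub_sq_div_one_add_nonneg hc₀
  have hlast : 0 ≤ Real.log n * (1 - c) ^ t₃ :=
    mul_nonneg hn.le (pow_nonneg (by linarith) t₃)
  have hstart := hcut.failProb_largeSets_le hc₀ hk.le hkn (Finset.singleton_nonempty v) t₀
  rw [Finset.card_singleton, Nat.cast_one, inv_one, mul_one] at hstart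
  refine failProb_add_le (le_protocolStep pull) (by positivity) hstart fun J hJ =>
    failProb_add_le (le_protocolStep pull) (by positivity)
      (hgrow.failProb_largeSets_le ha hγ hk hm.le hφa hφb hJ t₁) fun K hK =>
      failProb_add_le (le_protocolStep pull) hlast ?_ fun L hL =>
        hcut.failProb_almostAll_le hc₁ hn hL t₃
  have hKpos : (0 : ℝ) < K.card := hm.trans_le hK
  refine (hcut.failProb_largeSets_le hc₀ (by positivity) le_rfl
    (Finset.card_pos.1 (by exact_mod_cast hKpos)) t₂).trans ?_
  gcongr
  exact hK

end Phases

section Timing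

lemma exists_rate_lt {γ κ : ℝ} (hγ : 0 < γ) (hκ : 0 < κ) :
    ∃ ρ, (1 + γ)⁻¹ < ρ ∧ ρ < 1 ∧ 1 < -Real.log ρ * ((Real.log (1 + γ))⁻¹ + κ) := by
  have hlog : 0 < Real.log (1 + γ) := Real.log_pos (by linarith)
  have hcont : ContinuousAt (fun ρ => -Real.log ρ * ((Real.log (1 + γ))⁻¹ + κ)) (1 + γ)⁻¹ :=
    (Real.continuousAt_log (by positivity)).neg.mul continuousAt_const
  have hval : 1 < -Real.log (1 + γ)⁻¹ * ((Real.log (1 + γ))⁻¹ + κ) := by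
    rw [Real.log_inv, neg_neg, mul_add, mul_inv_cancel₀ hlog.ne']
    linarith [mul_pos hlog hκ]
  have hnear : ∀ᶠ ρ in 𝓝 (1 + γ)⁻¹, 1 < -Real.log ρ * ((Real.log (1 + γ))⁻¹ + κ) ∧ ρ < 1 :=
    (hcont.eventually (lt_mem_nhds hval)).and
      (gt_mem_nhds (inv_lt_one_of_one_lt₀ (by linarith)))
  obtain ⟨ρ, ⟨hρlog, hρ₁⟩, hρ⟩ :=
    ((hnear.filter_mono nhdsWithin_le_nhds).and
      (self_mem_nhdsWithin (s := Set.Ioi (1 + γ)⁻¹))).exists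
  exact ⟨ρ, hρ, hρ₁, hρlog⟩

lemma exists_loss_size_le_rate {γ ρ : ℝ} (a b : ℝ) (hγ : 0 < γ) (hρ : (1 + γ)⁻¹ < ρ) :
    ∃ ξ k, 0 < ξ ∧ ξ < γ ∧ 0 < k ∧ (1 + (γ - ξ))⁻¹ + b / (a * k) ≤ ρ := by
  have hcont : ContinuousAt (fun ξ : ℝ => (1 + (γ - ξ))⁻¹ + b / a * ξ) 0 :=
    (ContinuousAt.inv₀ (by fun_prop) (by rw [sub_zero]; positivity)).add (by fun_prop)
  have hnear : ∀ᶠ ξ in 𝓝 (0 : ℝ), (1 + (γ - ξ))⁻¹ + b / a * ξ < ρ ∧ ξ < γ :=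
    (hcont.eventually (gt_mem_nhds (by simpa using hρ))).and (gt_mem_nhds hγ)
  obtain ⟨ξ, ⟨hξρ, hξγ⟩, hξ⟩ :=
    ((hnear.filter_mono nhdsWithin_le_nhds).and (self_mem_nhdsWithin (s := Set.Ioi 0))).exists
  refine ⟨ξ, ξ⁻¹, hξ, hξγ, inv_pos.2 hξ, le_trans (le_of_eq ?_) hξρ.le⟩
  rw [← div_div, div_inv_eq_mul]

lemma tendsto_log_natCast_atTop : Tendsto (fun n : ℕ => Real.log n) atTop atTop :=
  Real.tendsto_log_atTop.comp tendsto_natCast_atTop_atTop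

lemma tendsto_ceil_mul_log_atTop {κ : ℝ} (hκ : 0 < κ) :
    Tendsto (fun n : ℕ => ⌈κ * Real.log n⌉₊) atTop atTop :=
  tendsto_nat_ceil_atTop.comp (tendsto_log_natCast_atTop.const_mul_atTop hκ)

lemma tendsto_pow_ceil_mul_log {r κ : ℝ} (hr₀ : 0 ≤ r) (hr₁ : r < 1) (hκ : 0 < κ) :
    Tendsto (fun n : ℕ => r ^ ⌈κ * Real.log n⌉₊) atTop (𝓝 0) :=
  (tendsto_pow_atTop_nhds_zero_of_lt_one hr₀ hr₁).comp (tendsto_ceil_mul_log_atTop hκ)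

lemma tendsto_log_mul_pow_ceil_mul_log {r κ : ℝ} (hr₀ : 0 ≤ r) (hr₁ : r < 1) (hκ : 0 < κ) :
    Tendsto (fun n : ℕ => Real.log n * r ^ ⌈κ * Real.log n⌉₊) atTop (𝓝 0) := by
  have hceil := ((tendsto_self_mul_const_pow_of_lt_one hr₀ hr₁).comp
    (tendsto_ceil_mul_log_atTop hκ)).const_mul κ⁻¹
  rw [mul_zero] at hceil
  refine squeeze_zero (fun n => mul_nonneg (Real.log_natCast_nonneg n) (by positivity))
    (fun n => ?_) hceil
  rw [Function.comp_apply, ← mul_assoc]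
  gcongr
  rw [inv_mul_eq_div, le_div_iff₀ hκ, mul_comm]
  exact Nat.le_ceil _

lemma tendsto_mul_pow_ceil_mul_log {ρ β : ℝ} (hρ₀ : 0 < ρ) (hρ₁ : ρ < 1)
    (hβ : 1 < -Real.log ρ * β) :
    Tendsto (fun n : ℕ => n * ρ ^ ⌈β * Real.log n⌉₊) atTop (𝓝 0) := by
  have hexp : Tendsto (fun n : ℕ => Real.exp (-((-Real.log ρ * β - 1) * Real.log n))) atTop
      (𝓝 0) :=
    Real.tendsto_exp_neg_atTop_nhds_zero.comp
      (tendsto_log_natCast_atTop.const_mul_atTop (sub_pos.2 hβ))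
  refine squeeze_zero' (.of_forall fun n => by positivity) ?_ hexp
  filter_upwards [eventually_gt_atTop 0] with n hn
  have hn₀ : (0 : ℝ) < n := by exact_mod_cast hn
  have hceil := mul_le_mul_of_nonneg_left (Nat.le_ceil (β * Real.log n))
    (neg_pos.2 (Real.log_neg hρ₀ hρ₁)).le
  calc (n : ℝ) * ρ ^ ⌈β * Real.log n⌉₊
      = Real.exp (Real.log n + Real.log ρ * ⌈β * Real.log n⌉₊) := by
        rw [Real.exp_add, Real.exp_log hn₀, ← Real.rpow_natCast, Real.rpow_def_of_pos hρ₀]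
    _ ≤ Real.exp (-((-Real.log ρ * β - 1) * Real.log n)) := Real.exp_le_exp.2 (by linarith)

lemma tendsto_sum_phase_failures {a b c θ k ρ κ β : ℝ} (hc₀ : 0 < c) (hc₁ : c ≤ 1) (hκ : 0 < κ)
    (hρ₀ : 0 < ρ) (hρ₁ : ρ < 1) (hβ : 1 < -Real.log ρ * β) :
    Tendsto (fun n : ℕ => k * (1 - (c / (1 + c)) ^ 2) ^ ⌈κ * Real.log n⌉₊ +
      (b * (θ * n) * (ρ ^ ⌈β * Real.log n⌉₊ * (a * k)⁻¹) +
        (n / 2 * ((1 - (c / (1 + c)) ^ 2) ^ ⌈κ * Real.log n⌉₊ * (θ * n)⁻¹) +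
          Real.log n * (1 - c) ^ ⌈κ * Real.log n⌉₊))) atTop (𝓝 0) := by
  have hcut := tendsto_pow_ceil_mul_log (one_sub_sq_div_one_add_nonneg hc₀)
    (sub_lt_self 1 (by positivity)) hκ
  have hlim := (hcut.const_mul k).add
    (((tendsto_mul_pow_ceil_mul_log hρ₀ hρ₁ hβ).const_mul (b * θ * (a * k)⁻¹)).add
      ((hcut.const_mul (2 * θ)⁻¹).add
        (tendsto_log_mul_pow_ceil_mul_log (r := 1 - c) (by linarith) (by linarith) hκ)))
  simp only [mul_zero, add_zero] at hlim
  refine hlim.congr' ?_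
  filter_upwards [eventually_gt_atTop 0] with n hn
  have hn₀ : (n : ℝ) ≠ 0 := by exact_mod_cast hn.ne'
  rw [mul_inv, mul_inv]
  field_simp

theorem eventually_exists_time_failProb_almostAll_le (H : (n : ℕ) → SimpleGraph (Fin n))
    [∀ n, DecidableRel (H n).Adj] {q : unitInterval} {pull : Bool} {γ a b c : ℝ} (hγ : 0 < γ)
    (ha : 0 < a) (hb : 0 < b) (hc₀ : 0 < c) (hc₁ : c ≤ 1)
    (hcut : ∀ᶠ n : ℕ in atTop, HasCutGain (H n) q pull c)
    (hgrow : ∀ ξ : ℝ, 0 < ξ → ∃ θ : ℝ, 0 < θ ∧ ∀ᶠ n : ℕ in atTop, ∃ φ : Fin n → ℝ,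
      (∀ w, a ≤ φ w) ∧ (∀ w, φ w ≤ b) ∧ HasGrowth (H n) q pull φ (γ - ξ) (θ * n))
    {κ η : ℝ} (hκ : 0 < κ) (hη : 0 < η) :
    ∀ᶠ n : ℕ in atTop, ∃ t : ℕ, (t : ℝ) ≤ ((Real.log (1 + γ))⁻¹ + κ) * Real.log n ∧
      ∀ v : Fin n, failProb (roundLaw (H n) q) (protocolStep pull)
        (largeSets n (n - n / Real.log n)) t {v} ≤ η := by
  obtain ⟨κ', hκ', rfl⟩ : ∃ κ', 0 < κ' ∧ κ = 5 * κ' := ⟨κ / 5, by positivity, by ring⟩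
  obtain ⟨ρ, hγρ, hρ₁, hρβ⟩ := exists_rate_lt hγ hκ'
  have hρ₀ : 0 < ρ := lt_trans (by positivity) hγρ
  have hβ : 0 < (Real.log (1 + γ))⁻¹ := inv_pos.2 (Real.log_pos (by linarith))
  set β := (Real.log (1 + γ))⁻¹
  obtain ⟨ξ, k, hξ, hξγ, hk, hrate⟩ := exists_loss_size_le_rate a b hγ hγρ
  obtain ⟨θ, hθ, hgrow⟩ := hgrow ξ hξ
  have hfail := (tendsto_sum_phase_failures (a := a) (b := b) (θ := θ) (k := k) hc₀ hc₁ hκ' hρ₀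
    hρ₁ hρβ).eventually_le_const hη
  filter_upwards [hfail, hcut, hgrow, tendsto_log_natCast_atTop.eventually_ge_atTop (4 / κ'),
    tendsto_log_natCast_atTop.eventually_gt_atTop 0,
    tendsto_natCast_atTop_atTop.eventually_ge_atTop (2 * k)] with n hfail hcut hgrow hlog4 hlog hnk
  obtain ⟨φ, hφa, hφb, hgrow⟩ := hgrow
  set τ := ⌈κ' * Real.log n⌉₊
  set τ' := ⌈(β + κ') * Real.log n⌉₊
  refine ⟨τ + (τ' + (τ + τ)), ?_, fun v => le_trans ?_ hfail⟩
  · have hτ : (τ : ℝ) < κ' * Real.log n + 1 := Nat.ceil_lt_add_one (by positivity)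
    have hτ' : (τ' : ℝ) < (β + κ') * Real.log n + 1 := Nat.ceil_lt_add_one (by positivity)
    rw [div_le_iff₀ hκ'] at hlog4
    push_cast
    linarith
  · have hn₀ : (0 : ℝ) < n := by linarith
    have : 0 < 1 + (γ - ξ) := by linarith
    refine (failProb_almostAll_le_of_hasCutGain_of_hasGrowth hcut hgrow hc₀ hc₁ ha hb
      (sub_pos.2 hξγ) hk (by linarith) (by positivity) hlog hφa hφb τ τ' τ τ v).trans ?_
    gcongr

end Timing

section Spectral

open Matrix

lemma sum_mul_sq_le_of_forall_ne_le {ι : Type*} [Fintype ι] {i₀ : ι} {f y : ι → ℝ} {D l : ℝ}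
    (hl : 0 ≤ l) (hD : f i₀ ≤ D) (hfl : ∀ i, i ≠ i₀ → f i ≤ l) :
    ∑ i, f i * y i ^ 2 ≤ D * y i₀ ^ 2 + l * ∑ i, y i ^ 2 := by
  classical
  rw [← Finset.add_sum_erase _ _ (Finset.mem_univ i₀), Finset.mul_sum]
  gcongr ?_ * _ + ?_
  calc ∑ i ∈ Finset.univ.erase i₀, f i * y i ^ 2
      ≤ ∑ i ∈ Finset.univ.erase i₀, l * y i ^ 2 := by
        gcongr with i hi
        exact hfl i (Finset.ne_of_mem_erase hi)
    _ ≤ ∑ i, l * y i ^ 2 :=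
        Finset.sum_le_univ_sum_of_nonneg fun i => mul_nonneg hl (sq_nonneg _)

variable {ι : Type*} [Fintype ι] [DecidableEq ι] {A : Matrix ι ι ℝ} (hA : A.IsHermitian)

lemma dotProduct_eq_sum_eigenvectorBasis (x y : ι → ℝ) :
    x ⬝ᵥ y = ∑ i, (⇑(hA.eigenvectorBasis i) ⬝ᵥ x) * (⇑(hA.eigenvectorBasis i) ⬝ᵥ y) := by
  have hparseval := hA.eigenvectorBasis.sum_inner_mul_inner (WithLp.toLp 2 x) (WithLp.toLp 2 y)
  simp only [EuclideanSpace.inner_eq_star_dotProduct, star_trivial] at hparseval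
  rw [dotProduct_comm x y, ← hparseval]
  simp only [dotProduct_comm y]

lemma eigenvectorBasis_dotProduct_mulVec (i : ι) (x : ι → ℝ) :
    ⇑(hA.eigenvectorBasis i) ⬝ᵥ (A *ᵥ x) =
      hA.eigenvalues i * (⇑(hA.eigenvectorBasis i) ⬝ᵥ x) := by
  have hT : Aᵀ = A := (conjTranspose_eq_transpose_of_trivial A).symm.trans hA
  rw [dotProduct_mulVec, ← mulVec_transpose, hT, hA.mulVec_eigenvectorBasis, smul_dotProduct,
    smul_eq_mul]

lemma eigenvectorBasis_dotProduct_self (i : ι) :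
    ⇑(hA.eigenvectorBasis i) ⬝ᵥ ⇑(hA.eigenvectorBasis i) = 1 := by
  have hnorm : inner ℝ (hA.eigenvectorBasis i) (hA.eigenvectorBasis i) = (1 : ℝ) := by
    rw [real_inner_self_eq_norm_sq, hA.eigenvectorBasis.orthonormal.1 i, one_pow]
  rwa [EuclideanSpace.inner_eq_star_dotProduct, star_trivial] at hnorm

lemma abs_eigenvalues_le_of_sum_abs_le {D : ℝ} (hD : ∀ u, ∑ w, |A u w| ≤ D) (i : ι) :
    |hA.eigenvalues i| ≤ D := by
  have heig : Module.End.HasEigenvalue (toLin' A) (hA.eigenvalues i) := by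
    rw [Module.End.hasEigenvalue_iff_mem_spectrum, spectrum_toLin']
    exact hA.eigenvalues_mem_spectrum_real i
  obtain ⟨u, hu⟩ := eigenvalue_mem_ball heig
  rw [mem_closedBall_iff_norm, Real.norm_eq_abs] at hu
  have hrow := Finset.add_sum_erase Finset.univ (fun w => |A u w|) (Finset.mem_univ u)
  calc |hA.eigenvalues i| ≤ |A u u| + |hA.eigenvalues i - A u u| := by
        linarith [abs_sub_abs_le_abs_sub (hA.eigenvalues i) (A u u)]
    _ ≤ |A u u| + ∑ w ∈ Finset.univ.erase u, |A u w| := by gcongr; exact hu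
    _ = ∑ w, |A u w| := hrow
    _ ≤ D := hD u

variable {i₀ : ι} {D l : ℝ}

lemma dotProduct_mulVec_le_of_eigenvalues_le (hl : 0 ≤ l) (hD : |hA.eigenvalues i₀| ≤ D)
    (hne : ∀ i, i ≠ i₀ → |hA.eigenvalues i| ≤ l) (x : ι → ℝ) :
    x ⬝ᵥ (A *ᵥ x) ≤ D * (⇑(hA.eigenvectorBasis i₀) ⬝ᵥ x) ^ 2 + l * (x ⬝ᵥ x) := by
  rw [dotProduct_eq_sum_eigenvectorBasis hA x x, dotProduct_eq_sum_eigenvectorBasis hA x]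
  simp only [eigenvectorBasis_dotProduct_mulVec, mul_left_comm, ← sq]
  exact sum_mul_sq_le_of_forall_ne_le hl ((le_abs_self _).trans hD)
    fun i hi => (le_abs_self _).trans (hne i hi)

lemma mulVec_dotProduct_mulVec_le_of_eigenvalues_le (hD : |hA.eigenvalues i₀| ≤ D)
    (hne : ∀ i, i ≠ i₀ → |hA.eigenvalues i| ≤ l) (x : ι → ℝ) :
    (A *ᵥ x) ⬝ᵥ (A *ᵥ x) ≤
      D ^ 2 * (⇑(hA.eigenvectorBasis i₀) ⬝ᵥ x) ^ 2 + l ^ 2 * (x ⬝ᵥ x) := by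
  rw [dotProduct_eq_sum_eigenvectorBasis hA x x, dotProduct_eq_sum_eigenvectorBasis hA (A *ᵥ x)]
  simp only [eigenvectorBasis_dotProduct_mulVec, ← sq, mul_pow]
  exact sum_mul_sq_le_of_forall_ne_le (sq_nonneg l) (sq_le_sq.2 (hD.trans (le_abs_self D)))
    fun i hi => sq_le_sq.2 ((hne i hi).trans (le_abs_self l))

end Spectral

section DegreeInto

variable {V : Type*} (G : SimpleGraph V) [DecidableRel G.Adj]

/-- The number of neighbours of `w` in `S`. -/
def degInto (S : Finset V) (w : V) : ℝ := ∑ u ∈ S, if G.Adj w u then 1 else 0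

variable {G}

lemma degInto_le_card (S : Finset V) (w : V) : degInto G S w ≤ S.card :=
  calc degInto G S w ≤ ∑ _u ∈ S, (1 : ℝ) := Finset.sum_le_sum fun u _ => by split_ifs <;> simp
    _ = S.card := by simp

lemma degInto_mono {H : SimpleGraph V} [DecidableRel H.Adj] (h : H ≤ G) (S : Finset V) (w : V) :
    degInto H S w ≤ degInto G S w :=
  Finset.sum_le_sum fun u _ => by
    by_cases hu : H.Adj w u
    · simp [hu, h hu]
    · rw [if_neg hu]
      positivity

lemma sum_degInto_comm (S T : Finset V) : ∑ w ∈ S, degInto G T w = ∑ w ∈ T, degInto G S w := by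
  simp only [degInto]
  rw [Finset.sum_comm]
  simp_rw [G.adj_comm]

variable [Fintype V]

lemma degInto_univ (w : V) : degInto G Finset.univ w = G.degree w := by
  simp [degInto, ← SimpleGraph.card_neighborFinset_eq_degree, SimpleGraph.neighborFinset_eq_filter]

lemma degInto_le_degree (S : Finset V) (w : V) : degInto G S w ≤ G.degree w := by
  rw [← degInto_univ]
  exact Finset.sum_le_sum_of_subset_of_nonneg (Finset.subset_univ S) fun _ _ _ => by
    split_ifs <;> simp

lemma degInto_add_compl [DecidableEq V] (S : Finset V) (w : V) :
    degInto G S w + degInto G Sᶜ w = G.degree w := by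
  rw [← degInto_univ, degInto, degInto, Finset.sum_add_sum_compl, degInto]

end DegreeInto

section Mixing

open Matrix

section IndicatorVector

variable {V : Type*} [Fintype V] [DecidableEq V]

/-- The indicator vector of `S`. -/
def indVec (S : Finset V) : V → ℝ := fun w => if w ∈ S then 1 else 0

lemma indVec_dotProduct (S : Finset V) (x : V → ℝ) : indVec S ⬝ᵥ x = ∑ w ∈ S, x w := by
  simp [indVec, dotProduct]

lemma indVec_univ_dotProduct_indVec (S : Finset V) : indVec Finset.univ ⬝ᵥ indVec S = S.card := by
  simp [indVec, dotProduct]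

lemma indVec_dotProduct_self (S : Finset V) : indVec S ⬝ᵥ indVec S = S.card := by
  rw [indVec_dotProduct]
  simp [indVec]

lemma adjMatrix_mulVec_indVec (G : SimpleGraph V) [DecidableRel G.Adj] (S : Finset V) :
    G.adjMatrix ℝ *ᵥ indVec S = degInto G S := by
  funext w
  simp only [mulVec, dotProduct, indVec, degInto, SimpleGraph.adjMatrix_apply, mul_ite, mul_one,
    mul_zero, Finset.sum_ite_mem, Finset.univ_inter]

end IndicatorVector

lemma add_sq_le_of_pos {ζ : ℝ} (hζ : 0 < ζ) (p r : ℝ) :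
    (p + r) ^ 2 ≤ (1 + ζ) * p ^ 2 + (1 + ζ⁻¹) * r ^ 2 := by
  have hsplit : (1 + ζ) * p ^ 2 + (1 + ζ⁻¹) * r ^ 2 - (p + r) ^ 2 = ζ⁻¹ * (ζ * p - r) ^ 2 := by
    field_simp
    ring
  have : 0 ≤ ζ⁻¹ * (ζ * p - r) ^ 2 := by positivity
  linarith

lemma sq_dotProduct_le_dotProduct_mul_dotProduct {ι : Type*} [Fintype ι] (x y : ι → ℝ) :
    (x ⬝ᵥ y) ^ 2 ≤ (x ⬝ᵥ x) * (y ⬝ᵥ y) := by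
  simpa only [dotProduct, sq] using Finset.sum_mul_sq_le_sq_mul_sq Finset.univ x y

lemma dotProduct_self_sub_smul {ι : Type*} [Fintype ι] {v e : ι → ℝ} (he : e ⬝ᵥ e ≠ 0) :
    (v - ((v ⬝ᵥ e) / (e ⬝ᵥ e)) • e) ⬝ᵥ (v - ((v ⬝ᵥ e) / (e ⬝ᵥ e)) • e) =
      v ⬝ᵥ v - (v ⬝ᵥ e) ^ 2 / (e ⬝ᵥ e) := by
  simp only [sub_dotProduct, dotProduct_sub, smul_dotProduct, dotProduct_smul, smul_eq_mul,
    dotProduct_comm e v]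
  field_simp
  ring

-- If `v` is almost parallel to `e`, then `v ⬝ᵥ x` is essentially the component of `x` along `e`.
lemma sq_dotProduct_le_of_almost_parallel {ι : Type*} [Fintype ι] {v e : ι → ℝ}
    (hv : v ⬝ᵥ v = 1) (he : 0 < e ⬝ᵥ e) {τ ζ : ℝ} (hζ : 0 < ζ)
    (hτ : 1 - (v ⬝ᵥ e) ^ 2 / (e ⬝ᵥ e) ≤ τ) (x : ι → ℝ) :
    (v ⬝ᵥ x) ^ 2 ≤ (1 + ζ) * ((e ⬝ᵥ x) ^ 2 / (e ⬝ᵥ e)) + (1 + ζ⁻¹) * (τ * (x ⬝ᵥ x)) := by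
  set a := v ⬝ᵥ e
  set r := v - (a / (e ⬝ᵥ e)) • e
  have hr : r ⬝ᵥ r = 1 - a ^ 2 / (e ⬝ᵥ e) := hv ▸ dotProduct_self_sub_smul he.ne'
  have hr₀ : 0 ≤ r ⬝ᵥ r := Finset.sum_nonneg fun _ _ => mul_self_nonneg _
  have hx₀ : 0 ≤ x ⬝ᵥ x := Finset.sum_nonneg fun _ _ => mul_self_nonneg _
  have hdecomp : v ⬝ᵥ x = a / (e ⬝ᵥ e) * (e ⬝ᵥ x) + r ⬝ᵥ x := by
    simp only [r, sub_dotProduct, smul_dotProduct, smul_eq_mul]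
    ring
  have hmain : (a / (e ⬝ᵥ e) * (e ⬝ᵥ x)) ^ 2 ≤ (e ⬝ᵥ x) ^ 2 / (e ⬝ᵥ e) := by
    have hsplit : (a / (e ⬝ᵥ e) * (e ⬝ᵥ x)) ^ 2 =
        a ^ 2 / (e ⬝ᵥ e) * ((e ⬝ᵥ x) ^ 2 / (e ⬝ᵥ e)) := by
      field_simp
    rw [hsplit]
    exact mul_le_of_le_one_left (by positivity) (by linarith)
  have hrest : (r ⬝ᵥ x) ^ 2 ≤ τ * (x ⬝ᵥ x) :=
    (sq_dotProduct_le_dotProduct_mul_dotProduct r x).trans (by gcongr; linarith)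
  rw [hdecomp]
  refine (add_sq_le_of_pos hζ _ _).trans ?_
  gcongr

variable {n : ℕ} (G : SimpleGraph (Fin n)) [DecidableRel G.Adj]

/-- The upper bounds of the expander mixing lemma with error `ξ`: the number of edges inside `S`
and the mean square of the degrees into `S` are at most what they would be in a random graph,
up to `ξ * |S|` on the scale of the maximum degree. -/
def IsMixing (ξ : ℝ) : Prop :=
  ∀ S : Finset (Fin n),
    ∑ w ∈ S, degInto G S w ≤ G.maxDegree * ((S.card : ℝ) ^ 2 / n + ξ * S.card) ∧
    ∑ w, degInto G S w ^ 2 ≤ G.maxDegree ^ 2 * ((S.card : ℝ) ^ 2 / n + ξ * S.card)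

variable {G}

lemma secondEigenvalue_nonneg : 0 ≤ secondEigenvalue G := Real.iSup_nonneg fun _ => abs_nonneg _

lemma abs_eigenvalues_le_maxDegree (i : Fin n) :
    |(G.isHermitian_adjMatrix ℝ).eigenvalues i| ≤ G.maxDegree := by
  refine abs_eigenvalues_le_of_sum_abs_le _ (fun u => ?_) i
  have hrow : ∑ w, |G.adjMatrix ℝ u w| = G.degree u := by
    simp [← degInto_univ, degInto, SimpleGraph.adjMatrix_apply, apply_ite abs]
  rw [hrow]
  exact_mod_cast G.degree_le_maxDegree u

lemma exists_forall_ne_abs_eigenvalues_le_secondEigenvalue (hn : 0 < n) :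
    ∃ i₀, ∀ i, i ≠ i₀ →
      |(G.isHermitian_adjMatrix ℝ).eigenvalues i| ≤ secondEigenvalue G := by
  let e : Fin (Fintype.card (Fin n)) ≃ Fin n := Fintype.equivOfCardEq (Fintype.card_fin _)
  refine ⟨e ⟨0, by simpa using hn⟩, fun i hi => ?_⟩
  have hne : (e.symm i : ℕ) ≠ 0 := fun h => hi (e.symm_apply_eq.1 (Fin.ext h))
  exact le_ciSup (f := fun i : {i : Fin (Fintype.card (Fin n)) // (i : ℕ) ≠ 0} =>
    |(G.isHermitian_adjMatrix ℝ).eigenvalues₀ i|) (Set.finite_range _).bddAbove ⟨e.symm i, hne⟩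

lemma secondEigenvalue_le_maxDegree : secondEigenvalue G ≤ G.maxDegree := by
  let e : Fin (Fintype.card (Fin n)) ≃ Fin n := Fintype.equivOfCardEq (Fintype.card_fin _)
  refine Real.iSup_le (fun i => ?_) (Nat.cast_nonneg _)
  rw [← e.symm_apply_apply i]
  exact abs_eigenvalues_le_maxDegree (e i)

lemma minDegree_mul_card_le_sum_degInto_univ :
    (G.minDegree : ℝ) * n ≤ ∑ w, degInto G Finset.univ w := by
  calc (G.minDegree : ℝ) * n = ∑ _w : Fin n, (G.minDegree : ℝ) := by simp [mul_comm]
    _ ≤ ∑ w, degInto G Finset.univ w := Finset.sum_le_sum fun w _ => by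
        rw [degInto_univ]
        exact_mod_cast G.minDegree_le_degree w

-- Testing the leading eigenvector against the all-ones vector shows that they are almost parallel,
-- because the average degree is close to the maximum degree.
lemma exists_vector_sq_dotProduct_indVec_le (hn : 0 < n) (hΔ : (0 : ℝ) < G.maxDegree)
    {ζ : ℝ} (hζ : 0 < ζ) :
    ∃ v : Fin n → ℝ, ∀ S : Finset (Fin n),
      (v ⬝ᵥ indVec S) ^ 2 ≤ (1 + ζ) * ((S.card : ℝ) ^ 2 / n) +
        (1 + ζ⁻¹) * ((1 - (G.minDegree - secondEigenvalue G) / G.maxDegree) * S.card) ∧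
      ∑ w ∈ S, degInto G S w ≤
        G.maxDegree * (v ⬝ᵥ indVec S) ^ 2 + secondEigenvalue G * S.card ∧
      ∑ w, degInto G S w ^ 2 ≤
        G.maxDegree ^ 2 * (v ⬝ᵥ indVec S) ^ 2 + secondEigenvalue G ^ 2 * S.card := by
  have hn₀ : (0 : ℝ) < n := by exact_mod_cast hn
  obtain ⟨i₀, hi₀⟩ := exists_forall_ne_abs_eigenvalues_le_secondEigenvalue (G := G) hn
  set hA := G.isHermitian_adjMatrix ℝ
  set v : Fin n → ℝ := ⇑(hA.eigenvectorBasis i₀)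
  have hedges : ∀ S : Finset (Fin n), ∑ w ∈ S, degInto G S w ≤
      G.maxDegree * (v ⬝ᵥ indVec S) ^ 2 + secondEigenvalue G * S.card := fun S => by
    rw [← indVec_dotProduct S, ← adjMatrix_mulVec_indVec, ← indVec_dotProduct_self S]
    exact dotProduct_mulVec_le_of_eigenvalues_le hA secondEigenvalue_nonneg
      (abs_eigenvalues_le_maxDegree i₀) hi₀ _
  have hcard : indVec (Finset.univ : Finset (Fin n)) ⬝ᵥ indVec Finset.univ = n := by
    rw [indVec_dotProduct_self, Finset.card_univ, Fintype.card_fin]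
  have hparallel : 1 - (v ⬝ᵥ indVec Finset.univ) ^ 2 / n ≤
      1 - (G.minDegree - secondEigenvalue G) / G.maxDegree := by
    have hones := minDegree_mul_card_le_sum_degInto_univ.trans (hedges Finset.univ)
    rw [Finset.card_univ, Fintype.card_fin] at hones
    rw [sub_le_sub_iff_left, div_le_div_iff₀ hΔ hn₀]
    linarith
  refine ⟨v, fun S => ⟨?_, hedges S, ?_⟩⟩
  · have := sq_dotProduct_le_of_almost_parallel
      (τ := 1 - (G.minDegree - secondEigenvalue G) / G.maxDegree)
      (eigenvectorBasis_dotProduct_self hA i₀) (hcard ▸ hn₀) hζ (by rwa [hcard]) (indVec S)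
    rwa [hcard, indVec_univ_dotProduct_indVec, indVec_dotProduct_self] at this
  · have := mulVec_dotProduct_mulVec_le_of_eigenvalues_le hA (abs_eigenvalues_le_maxDegree i₀) hi₀
      (indVec S)
    rwa [adjMatrix_mulVec_indVec, indVec_dotProduct_self, dotProduct, ← Finset.sum_congr rfl
      fun w _ => sq (degInto G S w)] at this

lemma isMixing_of_secondEigenvalue_le (hn : 0 < n) (hΔ : (0 : ℝ) < G.maxDegree) {ζ : ℝ}
    (hζ : 0 < ζ) (hl : secondEigenvalue G ≤ ζ * G.maxDegree)
    (hδ : (1 + ζ⁻¹) * (1 - (G.minDegree - secondEigenvalue G) / G.maxDegree) ≤ ζ) :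
    IsMixing G (3 * ζ) := by
  intro S
  obtain ⟨v, hv⟩ := exists_vector_sq_dotProduct_indVec_le hn hΔ hζ
  obtain ⟨hvS, hedges, hsquares⟩ := hv S
  have hcard : (S.card : ℝ) ^ 2 / n ≤ S.card := by
    rw [div_le_iff₀ (by exact_mod_cast hn), sq]
    gcongr
    simpa using Finset.card_le_univ S
  have hvS' : (v ⬝ᵥ indVec S) ^ 2 ≤ (S.card : ℝ) ^ 2 / n + 2 * ζ * S.card := by
    have hδS := mul_le_mul_of_nonneg_right hδ (Nat.cast_nonneg S.card)
    have hcardζ := mul_le_mul_of_nonneg_left hcard hζ.le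
    linarith
  refine ⟨hedges.trans ?_, hsquares.trans ?_⟩
  · calc _ ≤ (G.maxDegree : ℝ) * ((S.card : ℝ) ^ 2 / n + 2 * ζ * S.card) +
          ζ * G.maxDegree * S.card := by gcongr
      _ = _ := by ring
  · have hl₂ : secondEigenvalue G ^ 2 ≤ ζ * G.maxDegree * G.maxDegree := by
      rw [sq]
      exact mul_le_mul hl secondEigenvalue_le_maxDegree secondEigenvalue_nonneg (by positivity)
    calc _ ≤ (G.maxDegree : ℝ) ^ 2 * ((S.card : ℝ) ^ 2 / n + 2 * ζ * S.card) +
          ζ * G.maxDegree * G.maxDegree * S.card := by gcongr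
      _ = _ := by ring

end Mixing

namespace IsExpanderSequence

variable {G : (n : ℕ) → SimpleGraph (Fin n)} [∀ n, DecidableRel (G n).Adj]

lemma tendsto_minDegree_div_maxDegree (hG : IsExpanderSequence G) :
    Tendsto (fun n => ((G n).minDegree : ℝ) / ((G n).maxDegree : ℝ)) atTop (𝓝 1) := by
  simpa using hG.degree_ratio.inv₀ one_ne_zero

lemma eventually_minDegree_pos (hG : IsExpanderSequence G) :
    ∀ᶠ n in atTop, (0 : ℝ) < (G n).minDegree := by
  filter_upwards [hG.degree_ratio.eventually (lt_mem_nhds zero_lt_one)] with n hn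
  refine (Nat.cast_nonneg _).lt_of_ne fun h => ?_
  rw [← h, div_zero] at hn
  exact hn.false

lemma eventually_maxDegree_pos (hG : IsExpanderSequence G) :
    ∀ᶠ n in atTop, (0 : ℝ) < (G n).maxDegree := by
  filter_upwards [hG.eventually_minDegree_pos] with n hn
  exact hn.trans_le (by exact_mod_cast (G n).minDegree_le_maxDegree)

theorem eventually_isMixing (hG : IsExpanderSequence G) {ξ : ℝ} (hξ : 0 < ξ) :
    ∀ᶠ n in atTop, IsMixing (G n) ξ := by
  obtain ⟨ζ, hζ, rfl⟩ : ∃ ζ, 0 < ζ ∧ ξ = 3 * ζ := ⟨ξ / 3, by positivity, by ring⟩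
  have hl : Tendsto (fun n => secondEigenvalue (G n) / ((G n).maxDegree : ℝ)) atTop (𝓝 0) :=
    hG.eigenvalue_isLittleO.tendsto_div_nhds_zero
  have hδ : Tendsto (fun n => (1 + ζ⁻¹) * (1 - (((G n).minDegree : ℝ) -
      secondEigenvalue (G n)) / ((G n).maxDegree : ℝ))) atTop (𝓝 0) := by
    simpa [sub_div] using
      ((hG.tendsto_minDegree_div_maxDegree.sub hl).const_sub 1).const_mul (1 + ζ⁻¹)
  filter_upwards [hδ.eventually_le_const hζ, hl.eventually_le_const hζ,
    hG.eventually_maxDegree_pos, eventually_gt_atTop 0] with n hδ hl hΔ hn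
  exact isMixing_of_secondEigenvalue_le hn hΔ hζ ((div_le_iff₀ hΔ).1 hl) hδ

end IsExpanderSequence

section EdgeExpansion

variable {n : ℕ} {G H : SimpleGraph (Fin n)} [DecidableRel G.Adj] [DecidableRel H.Adj]

/-- Every cut of `H` contains at least `c` edges per vertex of its smaller side. -/
def HasEdgeExpansion (H : SimpleGraph (Fin n)) [DecidableRel H.Adj] (c : ℝ) : Prop :=
  ∀ S : Finset (Fin n), c * min (S.card : ℝ) (Sᶜ.card : ℝ) ≤ ∑ w ∈ Sᶜ, degInto H S w

lemma HasEdgeExpansion.mono {c c' : ℝ} (hH : HasEdgeExpansion H c) (hc : c' ≤ c) :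
    HasEdgeExpansion H c' := fun S =>
  (mul_le_mul_of_nonneg_right hc (by positivity)).trans (hH S)

lemma hasEdgeExpansion_of_card_le_half {c : ℝ}
    (h : ∀ S : Finset (Fin n), (S.card : ℝ) ≤ n / 2 → c * S.card ≤ ∑ w ∈ S, degInto H Sᶜ w) :
    HasEdgeExpansion H c := by
  intro S
  have hcard := cast_card_compl S
  rcases le_total (S.card : ℝ) (Sᶜ.card : ℝ) with hle | hle
  · rw [min_eq_left hle, ← sum_degInto_comm]
    exact h S (by linarith)
  · rw [min_eq_right hle]
    simpa only [compl_compl] using h Sᶜ (by linarith)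

lemma sq_card_div_add_le {S : Finset (Fin n)} {θ : ℝ} (hθ : 0 ≤ θ) (hS : (S.card : ℝ) ≤ θ * n)
    (ξ : ℝ) : (S.card : ℝ) ^ 2 / n + ξ * S.card ≤ (θ + ξ) * S.card := by
  have hsq : (S.card : ℝ) ^ 2 / n ≤ θ * S.card :=
    div_le_of_le_mul₀ (by positivity) (by positivity)
      (by nlinarith [Nat.cast_nonneg (α := ℝ) S.card])
  linarith

namespace IsMixing

lemma sum_degInto_le {ξ θ : ℝ} (hG : IsMixing G ξ) (hθ : 0 ≤ θ) {S : Finset (Fin n)}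
    (hS : (S.card : ℝ) ≤ θ * n) :
    ∑ w ∈ S, degInto G S w ≤ G.maxDegree * ((θ + ξ) * S.card) :=
  (hG S).1.trans (by gcongr; exact sq_card_div_add_le hθ hS ξ)

lemma sum_sq_degInto_le {ξ θ : ℝ} (hG : IsMixing G ξ) (hθ : 0 ≤ θ) {S : Finset (Fin n)}
    (hS : (S.card : ℝ) ≤ θ * n) :
    ∑ w, degInto G S w ^ 2 ≤ G.maxDegree ^ 2 * ((θ + ξ) * S.card) :=
  (hG S).2.trans (by gcongr; exact sq_card_div_add_le hθ hS ξ)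

end IsMixing

namespace IsDeletion

lemma mul_minDegree_le_degree {c : ℝ} (hH : IsDeletion c G H) (hc : 0 ≤ c) (v : Fin n) :
    c * G.minDegree ≤ H.degree v := by
  refine le_trans ?_ (hH.degree_le v)
  gcongr
  exact G.minDegree_le_degree v

lemma minDegree_div_two_le_degree {ε : ℝ} (hH : IsDeletion (1 / 2 + ε) G H) (hε : 0 < ε)
    (v : Fin n) : (G.minDegree : ℝ) / 2 ≤ H.degree v := by
  have hδ : (0 : ℝ) ≤ ε * G.minDegree := by positivity
  linarith [hH.mul_minDegree_le_degree (by positivity) v]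

lemma degree_le_maxDegree {c : ℝ} (hH : IsDeletion c G H) (v : Fin n) :
    (H.degree v : ℝ) ≤ G.maxDegree := by
  exact_mod_cast (SimpleGraph.degree_le_of_le hH.le).trans (G.degree_le_maxDegree v)

-- At most about half of the edges at a set of at most `n / 2` vertices of `G` stay inside the set,
-- so more than half of all edges at it cannot.
lemma hasEdgeExpansion {ε : ℝ} (hH : IsDeletion (1 / 2 + ε) G H) (hG : IsMixing G (ε / 4))
    (hε : 0 < ε) (hε₁ : ε < 1 / 2) (hδ : (1 - ε / 4) * G.maxDegree ≤ G.minDegree) :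
    HasEdgeExpansion H (ε / 2 * G.maxDegree) := by
  refine hasEdgeExpansion_of_card_le_half fun S hS => ?_
  have hsplit : ∑ w ∈ S, degInto H Sᶜ w =
      ∑ w ∈ S, (H.degree w : ℝ) - ∑ w ∈ S, degInto H S w := by
    rw [← Finset.sum_sub_distrib]
    exact Finset.sum_congr rfl fun w _ => by linarith [degInto_add_compl (G := H) S w]
  have hdegrees : (1 / 2 + ε) * ((1 - ε / 4) * G.maxDegree) * S.card ≤
      ∑ w ∈ S, (H.degree w : ℝ) := by
    calc _ ≤ (1 / 2 + ε) * (G.minDegree : ℝ) * S.card := by gcongr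
      _ = ∑ _w ∈ S, (1 / 2 + ε) * (G.minDegree : ℝ) := by
          rw [Finset.sum_const, nsmul_eq_mul, mul_comm]
      _ ≤ _ := Finset.sum_le_sum fun w _ => hH.mul_minDegree_le_degree (by positivity) w
  have hinside : ∑ w ∈ S, degInto H S w ≤ G.maxDegree * ((1 / 2 + ε / 4) * S.card) :=
    (Finset.sum_le_sum fun w _ => degInto_mono hH.le S w).trans
      (hG.sum_degInto_le (by norm_num) (by linarith))
  have hslack : 0 ≤ ε * (G.maxDegree * S.card) * (1 / 2 - ε) :=
    mul_nonneg (by positivity) (sub_nonneg.2 hε₁.le)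
  nlinarith

end IsDeletion

end EdgeExpansion

section Rates

variable {n : ℕ} {G H : SimpleGraph (Fin n)} [DecidableRel G.Adj] [DecidableRel H.Adj]
  {q : unitInterval} {d D K : ℝ}

lemma degree_pos_of_le (hd : 0 < d) (hdeg : ∀ v, d ≤ (H.degree v : ℝ)) (v : Fin n) :
    0 < H.degree v := by
  exact_mod_cast hd.trans_le (hdeg v)

lemma sum_callProb_le (hd : 0 < d) (hdeg : ∀ v, d ≤ (H.degree v : ℝ)) (S : Finset (Fin n))
    (w : Fin n) : ∑ u ∈ S, callProb H q u w ≤ d⁻¹ * degInto H S w := by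
  rw [degInto, Finset.mul_sum]
  refine Finset.sum_le_sum fun u _ => ?_
  rw [callProb_eq (degree_pos_of_le hd hdeg u)]
  simp only [H.adj_comm w u]
  split_ifs
  · rw [mul_one, ← one_div]
    exact div_le_div₀ zero_le_one q.2.2 hd (hdeg u)
  · simp

lemma le_sum_callProb (hpos : ∀ v, 0 < H.degree v) (hdeg : ∀ v, (H.degree v : ℝ) ≤ D)
    (S : Finset (Fin n)) (w : Fin n) :
    q / D * degInto H S w ≤ ∑ u ∈ S, callProb H q u w := by
  rw [degInto, Finset.mul_sum]
  refine Finset.sum_le_sum fun u _ => ?_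
  rw [callProb_eq (hpos u)]
  simp only [H.adj_comm w u]
  split_ifs
  · rw [mul_one]
    exact div_le_div_of_nonneg_left q.2.1 (by exact_mod_cast hpos u) (hdeg u)
  · simp

lemma sum_univ_callProb {u : Fin n} (hu : 0 < H.degree u) : ∑ w, callProb H q u w = q := by
  have hu' : (H.degree u : ℝ) ≠ 0 := by exact_mod_cast hu.ne'
  calc ∑ w, callProb H q u w = ∑ w, (q / H.degree u : ℝ) * if H.Adj u w then 1 else 0 :=
        Finset.sum_congr rfl fun w _ => by rw [callProb_eq hu, mul_ite, mul_one, mul_zero]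
    _ = q / H.degree u * degInto H Finset.univ u := (Finset.mul_sum _ _ _).symm
    _ = q := by rw [degInto_univ, div_mul_cancel₀ _ hu']

lemma HasEdgeExpansion.hasCutGain {c : ℝ} (hH : HasEdgeExpansion H c) (hd : 0 < d)
    (hlo : ∀ v, d ≤ (H.degree v : ℝ)) (hhi : ∀ v, (H.degree v : ℝ) ≤ D) (hD : 0 < D)
    (hK : D ≤ K * d) (pull : Bool) : HasCutGain H q pull (q * c / ((1 + K) * D)) := by
  intro J
  have hK₀ : 0 < K := pos_of_mul_pos_left (hD.trans_le hK) hd.le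
  have hinform : ∀ w ∈ Jᶜ, q / ((1 + K) * D) * degInto H J w ≤ informProb H q pull J w := by
    intro w hw
    have hrate₀ := contactRate_nonneg (G := H) (q := q) false J w
    have hrateK : contactRate H q false J w ≤ K := by
      rw [contactRate_false]
      refine (sum_callProb_le hd hlo J w).trans ?_
      rw [inv_mul_le_iff₀ hd, mul_comm d]
      exact ((degInto_le_degree J w).trans (hhi w)).trans hK
    have hrate : q / D * degInto H J w ≤ contactRate H q false J w := by
      rw [contactRate_false]
      exact le_sum_callProb (degree_pos_of_le hd hlo) hhi J w
    have hpull := contactRate_false_le (G := H) (q := q) pull J w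
    calc q / ((1 + K) * D) * degInto H J w = q / D * degInto H J w / (1 + K) := by field_simp
      _ ≤ contactRate H q false J w / (1 + contactRate H q false J w) := by gcongr
      _ ≤ contactRate H q pull J w / (1 + contactRate H q pull J w) := by
          rw [div_le_div_iff₀ (by linarith) (by linarith)]
          linarith
      _ ≤ informProb H q pull J w :=
          contactRate_div_one_add_le_informProb (Finset.mem_compl.1 hw)
  have hq₀ : (0 : ℝ) ≤ q := q.2.1
  calc q * c / ((1 + K) * D) * min (J.card : ℝ) (Jᶜ.card : ℝ)
      = q / ((1 + K) * D) * (c * min (J.card : ℝ) (Jᶜ.card : ℝ)) := by ring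
    _ ≤ q / ((1 + K) * D) * ∑ w ∈ Jᶜ, degInto H J w := by gcongr; exact hH J
    _ = ∑ w ∈ Jᶜ, q / ((1 + K) * D) * degInto H J w := Finset.mul_sum _ _ _
    _ ≤ ∑ w ∈ Jᶜ, 1 * informProb H q pull J w :=
        Finset.sum_le_sum fun w hw => (hinform w hw).trans_eq (one_mul _).symm

lemma sub_sq_le_div_one_add {s : ℝ} (hs : 0 ≤ s) : s - s ^ 2 ≤ s / (1 + s) := by
  rw [le_div_iff₀ (by linarith)]
  nlinarith [pow_nonneg hs 3]

lemma sum_contactRate_sub_sq_le_expectedGain (pull : Bool) (J : Finset (Fin n)) :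
    ∑ w ∈ Jᶜ, (contactRate H q pull J w - contactRate H q pull J w ^ 2) ≤
      expectedGain H q pull (fun _ => 1) J :=
  Finset.sum_le_sum fun w hw => by
    rw [one_mul]
    exact (sub_sq_le_div_one_add (contactRate_nonneg pull J w)).trans
      (contactRate_div_one_add_le_informProb (Finset.mem_compl.1 hw))

lemma sum_contactRate_false (hpos : ∀ v, 0 < H.degree v) (J : Finset (Fin n)) :
    ∑ w, contactRate H q false J w = q * J.card := by
  simp_rw [contactRate_false]
  rw [Finset.sum_comm, Finset.sum_congr rfl fun u _ => sum_univ_callProb (hpos u)]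
  simp [mul_comm]

lemma contactRate_false_le_degInto (hHG : H ≤ G) (hd : 0 < d) (hdeg : ∀ v, d ≤ (H.degree v : ℝ))
    (J : Finset (Fin n)) (w : Fin n) : contactRate H q false J w ≤ d⁻¹ * degInto G J w := by
  rw [contactRate_false]
  refine (sum_callProb_le hd hdeg J w).trans ?_
  gcongr
  exact degInto_mono hHG J w

namespace IsMixing

variable {ζ : ℝ} {J : Finset (Fin n)}

lemma sum_contactRate_false_le (hG : IsMixing G ζ) (hHG : H ≤ G) (hζ : 0 ≤ ζ) (hd : 0 < d)
    (hdeg : ∀ v, d ≤ (H.degree v : ℝ)) (hK : (G.maxDegree : ℝ) ≤ K * d)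
    (hJ : (J.card : ℝ) ≤ ζ * n) :
    ∑ w ∈ J, contactRate H q false J w ≤ K * ((ζ + ζ) * J.card) := by
  calc ∑ w ∈ J, contactRate H q false J w ≤ d⁻¹ * ∑ w ∈ J, degInto G J w := by
        rw [Finset.mul_sum]
        exact Finset.sum_le_sum fun w _ => contactRate_false_le_degInto hHG hd hdeg J w
    _ ≤ d⁻¹ * (G.maxDegree * ((ζ + ζ) * J.card)) := by
        gcongr
        exact hG.sum_degInto_le hζ hJ
    _ = d⁻¹ * G.maxDegree * ((ζ + ζ) * J.card) := by ring
    _ ≤ K * ((ζ + ζ) * J.card) := by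
        gcongr
        rwa [inv_mul_le_iff₀ hd, mul_comm d]

lemma sum_sq_contactRate_false_le (hG : IsMixing G ζ) (hHG : H ≤ G) (hζ : 0 ≤ ζ) (hd : 0 < d)
    (hdeg : ∀ v, d ≤ (H.degree v : ℝ)) (hK : (G.maxDegree : ℝ) ≤ K * d)
    (hJ : (J.card : ℝ) ≤ ζ * n) :
    ∑ w, contactRate H q false J w ^ 2 ≤ K ^ 2 * ((ζ + ζ) * J.card) := by
  calc ∑ w, contactRate H q false J w ^ 2 ≤ ∑ w, (d⁻¹ * degInto G J w) ^ 2 :=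
        Finset.sum_le_sum fun w _ => pow_le_pow_left₀ (contactRate_nonneg false J w)
          (contactRate_false_le_degInto hHG hd hdeg J w) 2
    _ = d⁻¹ ^ 2 * ∑ w, degInto G J w ^ 2 := by simp_rw [mul_pow, Finset.mul_sum]
    _ ≤ d⁻¹ ^ 2 * (G.maxDegree ^ 2 * ((ζ + ζ) * J.card)) := by
        gcongr
        exact hG.sum_sq_degInto_le hζ hJ
    _ = (d⁻¹ * G.maxDegree) ^ 2 * ((ζ + ζ) * J.card) := by ring
    _ ≤ K ^ 2 * ((ζ + ζ) * J.card) := by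
        gcongr
        rwa [inv_mul_le_iff₀ hd, mul_comm d]

-- A small set sends few calls into itself, and few vertices are called from it more than once.
lemma hasGrowth_push (hG : IsMixing G ζ) (hHG : H ≤ G) (hζ : 0 ≤ ζ) (hd : 0 < d)
    (hdeg : ∀ v, d ≤ (H.degree v : ℝ)) (hK : (G.maxDegree : ℝ) ≤ K * d) :
    HasGrowth H q false (fun _ => 1) (q - (K + K ^ 2) * (ζ + ζ)) (ζ * n) := by
  intro J hJ
  have hinside := hG.sum_contactRate_false_le (q := q) hHG hζ hd hdeg hK hJ
  have hsquares : ∑ w ∈ Jᶜ, contactRate H q false J w ^ 2 ≤ K ^ 2 * ((ζ + ζ) * J.card) :=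
    (Finset.sum_le_sum_of_subset_of_nonneg (Finset.subset_univ _) fun w _ _ => sq_nonneg _).trans
      (hG.sum_sq_contactRate_false_le hHG hζ hd hdeg hK hJ)
  have hgain := sum_contactRate_sub_sq_le_expectedGain (H := H) (q := q) false J
  rw [Finset.sum_sub_distrib] at hgain
  have htotal := sum_contactRate_false (q := q) (degree_pos_of_le hd hdeg) J
  rw [← Finset.sum_add_sum_compl J] at htotal
  simp only [Finset.sum_const, nsmul_eq_mul, mul_one]
  linarith

end IsMixing

end Rates

section Sequence

variable {G H : (n : ℕ) → SimpleGraph (Fin n)} [∀ n, DecidableRel (G n).Adj]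
  [∀ n, DecidableRel (H n).Adj] {ε : ℝ}

namespace IsExpanderSequence

lemma eventually_maxDegree_le (hG : IsExpanderSequence G) :
    ∀ᶠ n in atTop, ((G n).maxDegree : ℝ) ≤ 3 * ((G n).minDegree / 2) := by
  filter_upwards [hG.eventually_minDegree_pos,
    hG.degree_ratio.eventually_le_const (show (1 : ℝ) < 3 / 2 by norm_num)] with n hδ hratio
  rw [div_le_iff₀ hδ] at hratio
  linarith

lemma eventually_hasEdgeExpansion (hG : IsExpanderSequence G) (hε : 0 < ε) (hε₁ : ε < 1 / 2)
    (hH : ∀ n, IsDeletion (1 / 2 + ε) (G n) (H n)) :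
    ∀ᶠ n in atTop, HasEdgeExpansion (H n) (ε / 2 * (G n).maxDegree) := by
  filter_upwards [hG.eventually_isMixing (show 0 < ε / 4 by positivity),
    hG.eventually_maxDegree_pos, hG.tendsto_minDegree_div_maxDegree.eventually_const_le
      (show 1 - ε / 4 < 1 by linarith)] with n hmix hΔ hratio
  exact (hH n).hasEdgeExpansion hmix hε hε₁ ((le_div_iff₀ hΔ).1 hratio)

lemma eventually_hasCutGain (hG : IsExpanderSequence G) (hε : 0 < ε) (hε₁ : ε < 1 / 2)
    (hH : ∀ n, IsDeletion (1 / 2 + ε) (G n) (H n)) (q : unitInterval) (pull : Bool) :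
    ∀ᶠ n in atTop, HasCutGain (H n) q pull (q * ε / 8) := by
  filter_upwards [hG.eventually_hasEdgeExpansion hε hε₁ hH, hG.eventually_minDegree_pos,
    hG.eventually_maxDegree_pos, hG.eventually_maxDegree_le] with n hexp hδ hΔ hratio
  have hgain := hexp.hasCutGain (q := q) (half_pos hδ) ((hH n).minDegree_div_two_le_degree hε)
    (hH n).degree_le_maxDegree hΔ hratio pull
  convert hgain using 1
  field_simp
  ring

lemma eventually_hasGrowth_push (hG : IsExpanderSequence G) (hε : 0 < ε)
    (hH : ∀ n, IsDeletion (1 / 2 + ε) (G n) (H n)) (q : unitInterval) {ξ : ℝ} (hξ : 0 < ξ) :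
    ∀ᶠ n : ℕ in atTop, HasGrowth (H n) q false (fun _ => 1) (q - ξ) (ξ / 24 * n) := by
  filter_upwards [hG.eventually_isMixing (show 0 < ξ / 24 by positivity),
    hG.eventually_minDegree_pos, hG.eventually_maxDegree_le] with n hmix hδ hratio
  have hgrow := hmix.hasGrowth_push (q := q) (hH n).le (by positivity) (half_pos hδ)
    ((hH n).minDegree_div_two_le_degree hε) hratio
  convert hgrow using 1
  ring

end IsExpanderSequence

end Sequence

section Subsolution

open Matrix

variable {ι : Type*} [Fintype ι] {A : Matrix ι ι ℝ} {l : ℝ} {x : ι → ℝ}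

/-- A nonnegative vector `x` with `l * x ≤ A *ᵥ x` entrywise. For a nonnegative matrix it plays the
role of a Perron eigenvector, but it survives the smoothing that makes all entries comparable. -/
structure IsSubsolution (A : Matrix ι ι ℝ) (l : ℝ) (x : ι → ℝ) : Prop where
  nonneg : ∀ w, 0 ≤ x w
  mul_le : ∀ w, l * x w ≤ (A *ᵥ x) w

/-- One step of smoothing: the vector `x` is spread along the positive entries of `A`. -/
def smoothing (A : Matrix ι ι ℝ) (x : ι → ℝ) : ι → ℝ := x + A *ᵥ x

lemma mulVec_le_mul_sum {M : ℝ} (hM : ∀ u w, A u w ≤ M) (hx : ∀ w, 0 ≤ x w) (w : ι) :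
    (A *ᵥ x) w ≤ M * ∑ u, x u := by
  rw [Finset.mul_sum]
  exact Finset.sum_le_sum fun u _ => mul_le_mul_of_nonneg_right (hM w u) (hx u)

lemma mul_sum_le_mulVec (hA : ∀ u w, 0 ≤ A u w) (hx : ∀ w, 0 ≤ x w) {τ : ℝ} {S : Finset ι}
    (hS : ∀ u ∈ S, τ ≤ x u) (w : ι) : (∑ u ∈ S, A w u) * τ ≤ (A *ᵥ x) w := by
  calc (∑ u ∈ S, A w u) * τ ≤ ∑ u ∈ S, A w u * x u := by
        rw [Finset.sum_mul]
        exact Finset.sum_le_sum fun u hu => mul_le_mul_of_nonneg_left (hS u hu) (hA w u)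
    _ ≤ (A *ᵥ x) w := Finset.sum_le_sum_of_subset_of_nonneg (Finset.subset_univ S)
        fun u _ _ => mul_nonneg (hA w u) (hx u)

lemma mulVec_nonneg_of_nonneg (hA : ∀ u w, 0 ≤ A u w) (hx : ∀ w, 0 ≤ x w) (w : ι) :
    0 ≤ (A *ᵥ x) w :=
  Finset.sum_nonneg fun u _ => mul_nonneg (hA w u) (hx u)

lemma exists_le_eigenvalues [DecidableEq ι] (hA : A.IsHermitian) (hx : 0 < x ⬝ᵥ x)
    (hl : l * (x ⬝ᵥ x) ≤ x ⬝ᵥ (A *ᵥ x)) : ∃ i, l ≤ hA.eigenvalues i := by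
  by_contra! hlt
  rw [dotProduct_eq_sum_eigenvectorBasis hA x (A *ᵥ x)] at hl
  rw [dotProduct_eq_sum_eigenvectorBasis hA x x] at hl hx
  simp only [eigenvectorBasis_dotProduct_mulVec, mul_left_comm, ← sq] at hl hx
  obtain ⟨i, hi, hpos⟩ := Finset.exists_lt_of_sum_lt (Finset.sum_const_zero.trans_lt hx)
  refine hl.not_gt ?_
  rw [Finset.mul_sum]
  exact Finset.sum_lt_sum (fun j _ => mul_le_mul_of_nonneg_right (hlt j).le (sq_nonneg _))
    ⟨i, hi, mul_lt_mul_of_pos_right (hlt i) hpos⟩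

-- The entrywise absolute value of an eigenvector is a subsolution.
lemma exists_isSubsolution [Nonempty ι] (hA : A.IsHermitian) (hA₀ : ∀ u w, 0 ≤ A u w)
    (hl : 0 ≤ l) (hsum : l * Fintype.card ι ≤ ∑ u, ∑ w, A u w) :
    ∃ x, IsSubsolution A l x ∧ 0 < ∑ w, x w := by
  classical
  obtain ⟨i, hi⟩ : ∃ i, l ≤ hA.eigenvalues i :=
    exists_le_eigenvalues (x := 1) hA (by simp [Fintype.card_pos])
      (by simpa [dotProduct, mulVec] using hsum)
  set e : ι → ℝ := ⇑(hA.eigenvectorBasis i)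
  refine ⟨fun w => |e w|, ⟨fun w => abs_nonneg _, fun w => ?_⟩, ?_⟩
  · have heig : hA.eigenvalues i * e w = ∑ u, A w u * e u :=
      (congrFun (hA.mulVec_eigenvectorBasis i) w).symm
    calc l * |e w| ≤ hA.eigenvalues i * |e w| := by gcongr
      _ = |hA.eigenvalues i * e w| := by rw [abs_mul, abs_of_nonneg (hl.trans hi)]
      _ ≤ ∑ u, |A w u * e u| := heig ▸ Finset.abs_sum_le_sum_abs _ _
      _ = (A *ᵥ fun w => |e w|) w := Finset.sum_congr rfl fun u _ => by
          rw [abs_mul, abs_of_nonneg (hA₀ w u)]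
  · have hne : e ≠ 0 := fun h => by
      simpa [e, h] using eigenvectorBasis_dotProduct_self hA i
    obtain ⟨w, hw⟩ := Function.ne_iff.1 hne
    exact Finset.sum_pos' (fun _ _ => abs_nonneg _) ⟨w, Finset.mem_univ w, abs_pos.2 hw⟩

namespace IsSubsolution

lemma smul (hx : IsSubsolution A l x) {r : ℝ} (hr : 0 ≤ r) : IsSubsolution A l (r • x) where
  nonneg w := mul_nonneg hr (hx.nonneg w)
  mul_le w := by
    rw [mulVec_smul, Pi.smul_apply, Pi.smul_apply, smul_eq_mul, smul_eq_mul, mul_left_comm]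
    exact mul_le_mul_of_nonneg_left (hx.mul_le w) hr

lemma smooth (hx : IsSubsolution A l x) (hA : ∀ u w, 0 ≤ A u w) :
    IsSubsolution A l (smoothing A x) where
  nonneg w := add_nonneg (hx.nonneg w) (mulVec_nonneg_of_nonneg hA hx.nonneg w)
  mul_le w := by
    have hAx : l * (A *ᵥ x) w ≤ (A *ᵥ (A *ᵥ x)) w :=
      calc l * (A *ᵥ x) w = ∑ u, A w u * (l * x u) := by
            simp only [mulVec, dotProduct, Finset.mul_sum, mul_left_comm]
        _ ≤ (A *ᵥ (A *ᵥ x)) w :=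
            Finset.sum_le_sum fun u _ => mul_le_mul_of_nonneg_left (hx.mul_le u) (hA w u)
    rw [smoothing, mulVec_add, Pi.add_apply, Pi.add_apply, mul_add]
    exact add_le_add (hx.mul_le w) hAx

lemma iterate_smoothing (hx : IsSubsolution A l x) (hA : ∀ u w, 0 ≤ A u w) (k : ℕ) :
    IsSubsolution A l ((smoothing A)^[k] x) :=
  Function.Iterate.rec _ hx (fun _ hy => hy.smooth hA) k

end IsSubsolution

lemma iterate_smoothing_nonneg (hA : ∀ u w, 0 ≤ A u w) (hx : ∀ w, 0 ≤ x w) (k : ℕ) :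
    ∀ w, 0 ≤ (smoothing A)^[k] x w :=
  Function.Iterate.rec (fun y : ι → ℝ => ∀ w, 0 ≤ y w) hx
    (fun _ hy w => add_nonneg (hy w) (mulVec_nonneg_of_nonneg hA hy w)) k

lemma iterate_smoothing_le {K b : ℝ} (hA : ∀ u w, 0 ≤ A u w)
    (hK : ∀ u w, A u w ≤ K / Fintype.card ι) (hx : ∀ w, 0 ≤ x w) (hb : ∀ w, x w ≤ b) (k : ℕ)
    (w : ι) : (smoothing A)^[k] x w ≤ (1 + K) ^ k * b := by
  induction k generalizing w with
  | zero => simpa using hb w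
  | succ k ih =>
    rw [Function.iterate_succ_apply']
    set y := (smoothing A)^[k] x
    have hcard : (Fintype.card ι : ℝ) ≠ 0 := by exact_mod_cast (Fintype.card_pos_iff.2 ⟨w⟩).ne'
    have hK₀ : 0 ≤ K / Fintype.card ι := (hA w w).trans (hK w w)
    have hAy : (A *ᵥ y) w ≤ K * ((1 + K) ^ k * b) := by
      calc (A *ᵥ y) w ≤ K / Fintype.card ι * ∑ u, y u :=
            mulVec_le_mul_sum hK (iterate_smoothing_nonneg hA hx k) w
        _ ≤ K / Fintype.card ι * ∑ _u : ι, (1 + K) ^ k * b := by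
            gcongr with u
            exact ih u
        _ = K * ((1 + K) ^ k * b) := by
            rw [Finset.sum_const, nsmul_eq_mul, Finset.card_univ, ← mul_assoc,
              div_mul_cancel₀ _ hcard]
    calc y w + (A *ᵥ y) w ≤ (1 + K) ^ k * b + K * ((1 + K) ^ k * b) := add_le_add (ih w) hAy
      _ = (1 + K) ^ (k + 1) * b := by ring

end Subsolution

section Spreading

open Matrix

variable {ι : Type*} [Fintype ι] {A : Matrix ι ι ℝ} {x : ι → ℝ} {m β τ : ℝ}

/-- Every set of at least `m` indices can be enlarged by a proportion `β` of all indices, or to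
everything, using only indices whose row puts weight at least `β` on the set. -/
def IsSpreading (A : Matrix ι ι ℝ) (m β : ℝ) : Prop :=
  ∀ S : Finset ι, m ≤ S.card → ∃ T : Finset ι, S ⊆ T ∧ (∀ w ∈ T, w ∈ S ∨ β ≤ ∑ u ∈ S, A w u) ∧
    (T = Finset.univ ∨ S.card + β * Fintype.card ι ≤ (T.card : ℝ))

lemma mul_le_smoothing (hA : ∀ u w, 0 ≤ A u w) (hx : ∀ w, 0 ≤ x w) (hβ : β ≤ 1) (hτ : 0 ≤ τ)
    {S : Finset ι} (hS : ∀ u ∈ S, τ ≤ x u) {w : ι} (hw : w ∈ S ∨ β ≤ ∑ u ∈ S, A w u) :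
    β * τ ≤ smoothing A x w := by
  have hAx := mulVec_nonneg_of_nonneg hA hx w
  rcases hw with hw | hw
  · calc β * τ ≤ τ := mul_le_of_le_one_left hτ hβ
      _ ≤ x w := hS w hw
      _ ≤ smoothing A x w := le_add_of_nonneg_right hAx
  · calc β * τ ≤ (∑ u ∈ S, A w u) * τ := by gcongr
      _ ≤ (A *ᵥ x) w := mul_sum_le_mulVec hA hx hS w
      _ ≤ smoothing A x w := le_add_of_nonneg_left (hx w)

namespace IsSpreading

lemma exists_le_iterate_smoothing (hspread : IsSpreading A m β) (hA : ∀ u w, 0 ≤ A u w)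
    (hx : ∀ w, 0 ≤ x w) (hβ₀ : 0 ≤ β) (hβ₁ : β ≤ 1) (hτ : 0 ≤ τ) {S : Finset ι}
    (hm : m ≤ S.card) (hS : ∀ u ∈ S, τ ≤ x u) (k : ℕ) :
    ∃ T : Finset ι, m ≤ T.card ∧ (∀ w ∈ T, β ^ k * τ ≤ (smoothing A)^[k] x w) ∧
      (T = Finset.univ ∨ m + k * β * Fintype.card ι ≤ (T.card : ℝ)) := by
  induction k with
  | zero => exact ⟨S, hm, by simpa using hS, Or.inr (by simpa using hm)⟩
  | succ k ih =>
    obtain ⟨T, hmT, hT, hcard⟩ := ih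
    obtain ⟨U, hTU, hU, hcardU⟩ := hspread T hmT
    refine ⟨U, hmT.trans (by exact_mod_cast Finset.card_le_card hTU), fun w hw => ?_, ?_⟩
    · rw [Function.iterate_succ_apply', pow_succ', mul_assoc]
      exact mul_le_smoothing hA (iterate_smoothing_nonneg hA hx k) hβ₁ (by positivity) hT (hU w hw)
    · rcases hcardU with hU | hU
      · exact Or.inl hU
      · rcases hcard with rfl | hcard
        · exact Or.inl (Finset.univ_subset_iff.1 hTU)
        · refine Or.inr ?_
          push_cast
          linarith

lemma le_iterate_smoothing (hspread : IsSpreading A m β) (hA : ∀ u w, 0 ≤ A u w)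
    (hx : ∀ w, 0 ≤ x w) (hβ₀ : 0 < β) (hβ₁ : β ≤ 1) (hτ : 0 ≤ τ) (hm₀ : 0 < m) {S : Finset ι}
    (hm : m ≤ S.card) (hS : ∀ u ∈ S, τ ≤ x u) (w : ι) :
    β ^ ⌈β⁻¹⌉₊ * τ ≤ (smoothing A)^[⌈β⁻¹⌉₊] x w := by
  obtain ⟨T, -, hT, rfl | hcard⟩ :=
    hspread.exists_le_iterate_smoothing hA hx hβ₀.le hβ₁ hτ hm hS ⌈β⁻¹⌉₊
  · exact hT w (Finset.mem_univ w)
  · exfalso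
    have hsteps : (1 : ℝ) ≤ ⌈β⁻¹⌉₊ * β := by
      rw [← inv_mul_cancel₀ hβ₀.ne']
      gcongr
      exact Nat.le_ceil _
    have hTcard : (T.card : ℝ) ≤ Fintype.card ι := by exact_mod_cast Finset.card_le_univ T
    linarith [mul_le_mul_of_nonneg_right hsteps (Nat.cast_nonneg (α := ℝ) (Fintype.card ι))]

end IsSpreading

end Spreading

section Weight

variable {ι : Type*} [Fintype ι] {A : Matrix ι ι ℝ} {l K β : ℝ}

lemma sum_sub_le_mul_card_filter {x : ι → ℝ} {τ b : ℝ} (hτ : 0 ≤ τ) (hb : ∀ w, x w ≤ b) :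
    ∑ w, x w - τ * Fintype.card ι ≤ b * (Finset.univ.filter fun w => τ ≤ x w).card := by
  rw [← Finset.sum_filter_add_sum_filter_not Finset.univ fun w => τ ≤ x w]
  have hlarge : ∑ w with τ ≤ x w, x w ≤ b * (Finset.univ.filter fun w => τ ≤ x w).card := by
    rw [mul_comm, ← nsmul_eq_mul]
    exact Finset.sum_le_card_nsmul _ _ _ fun w _ => hb w
  have hsmall : ∑ w with ¬ τ ≤ x w, x w ≤ τ * Fintype.card ι := by
    calc _ ≤ (Finset.univ.filter fun w => ¬ τ ≤ x w).card • τ :=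
          Finset.sum_le_card_nsmul _ _ _ fun w hw => (not_le.1 (Finset.mem_filter.1 hw).2).le
      _ ≤ Fintype.card ι • τ := by
          gcongr
          exact Finset.card_le_univ _
      _ = _ := by rw [nsmul_eq_mul, mul_comm]
  linarith

-- A subsolution normalised to mean one is bounded, hence at least `1 / 2` on a positive proportion
-- of the indices, and boundedly many smoothing steps carry this bound to all indices.
theorem exists_isSubsolution_forall_mem_Icc [Nonempty ι] (hA : A.IsHermitian)
    (hA₀ : ∀ u w, 0 ≤ A u w) (hl : 0 < l) (hK : ∀ u w, A u w ≤ K / Fintype.card ι)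
    (hK₀ : 0 < K) (hsum : l * Fintype.card ι ≤ ∑ u, ∑ w, A u w) (hβ₀ : 0 < β) (hβ₁ : β ≤ 1)
    (hspread : IsSpreading A (l / (2 * K) * Fintype.card ι) β) :
    ∃ φ, IsSubsolution A l φ ∧
      ∀ w, φ w ∈ Set.Icc (β ^ ⌈β⁻¹⌉₊ * 2⁻¹) ((1 + K) ^ ⌈β⁻¹⌉₊ * (K / l)) := by
  have hn : (0 : ℝ) < Fintype.card ι := by exact_mod_cast Fintype.card_pos
  obtain ⟨x₀, hx₀, hsum₀⟩ := exists_isSubsolution hA hA₀ hl.le hsum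
  have hr : 0 < Fintype.card ι / ∑ w, x₀ w := by positivity
  set x := (Fintype.card ι / ∑ w, x₀ w) • x₀
  have hx : IsSubsolution A l x := hx₀.smul hr.le
  have hmean : ∑ w, x w = Fintype.card ι := by
    simp only [x, Pi.smul_apply, smul_eq_mul, ← Finset.mul_sum]
    exact div_mul_cancel₀ _ hsum₀.ne'
  have hbound : ∀ w, x w ≤ K / l := fun w => by
    rw [le_div_iff₀' hl]
    refine ((hx.mul_le w).trans (mulVec_le_mul_sum hK hx.nonneg w)).trans_eq ?_
    rw [hmean, div_mul_cancel₀ _ hn.ne']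
  have hlarge : l / (2 * K) * Fintype.card ι ≤ (Finset.univ.filter fun w => 2⁻¹ ≤ x w).card := by
    have hcard := sum_sub_le_mul_card_filter (by norm_num : (0 : ℝ) ≤ 2⁻¹) hbound
    rw [hmean, div_mul_eq_mul_div, le_div_iff₀' hl] at hcard
    rw [div_mul_eq_mul_div, div_le_iff₀ (by positivity)]
    linarith
  refine ⟨_, hx.iterate_smoothing hA₀ ⌈β⁻¹⌉₊, fun w => ⟨?_, ?_⟩⟩
  · exact hspread.le_iterate_smoothing hA₀ hx.nonneg hβ₀ hβ₁ (by norm_num) (by positivity) hlarge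
      (fun u hu => (Finset.mem_filter.1 hu).2) w
  · exact iterate_smoothing_le hA₀ hK hx.nonneg hbound _ w

end Weight

section RateMatrix

open Matrix

variable {n : ℕ} (H : SimpleGraph (Fin n)) [DecidableRel H.Adj]

/-- The matrix `D⁻¹ A + A D⁻¹`, where `A` is the adjacency matrix and `D` the diagonal matrix of
the degrees. Up to the factor `q`, the entry at `(w, u)` is the expected number of successful calls
between `u` and `w` in one round. -/
noncomputable def rateMatrix : Matrix (Fin n) (Fin n) ℝ :=
  fun u w => if H.Adj u w then (H.degree u : ℝ)⁻¹ + (H.degree w : ℝ)⁻¹ else 0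

lemma rateMatrix_nonneg (u w : Fin n) : 0 ≤ rateMatrix H u w := by
  unfold rateMatrix; split_ifs <;> positivity

lemma rateMatrix_comm (u w : Fin n) : rateMatrix H u w = rateMatrix H w u := by
  simp only [rateMatrix, H.adj_comm u w, add_comm]

lemma isHermitian_rateMatrix : (rateMatrix H).IsHermitian := by
  ext u w
  simp [rateMatrix_comm H w u]

variable {H} {q : unitInterval} {d : ℝ}

lemma mul_rateMatrix_eq (hpos : ∀ v, 0 < H.degree v) (u w : Fin n) :
    q * rateMatrix H w u = callProb H q u w + callProb H q w u := by
  rw [callProb_eq (hpos u), callProb_eq (hpos w)]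
  simp only [rateMatrix, H.adj_comm u w]
  split_ifs
  · ring
  · simp

lemma contactRate_true_eq (hpos : ∀ v, 0 < H.degree v) (J : Finset (Fin n)) (w : Fin n) :
    contactRate H q true J w = q * ∑ u ∈ J, rateMatrix H w u := by
  rw [contactRate_true, ← Finset.sum_add_distrib, Finset.mul_sum]
  exact Finset.sum_congr rfl fun u _ => (mul_rateMatrix_eq hpos u w).symm

lemma sum_rateMatrix (hpos : ∀ v, 0 < H.degree v) : ∑ u, ∑ w, rateMatrix H u w = 2 * n := by
  have hentry : ∀ u w, rateMatrix H u w = callProb H 1 w u + callProb H 1 u w := fun u w => by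
    rw [← mul_rateMatrix_eq hpos, Set.Icc.coe_one, one_mul]
  have hcalls : ∑ u, ∑ w, callProb H 1 u w = n := by
    simp [Finset.sum_congr rfl fun u _ => sum_univ_callProb (hpos u)]
  simp_rw [hentry, Finset.sum_add_distrib]
  rw [Finset.sum_comm, hcalls]
  ring

lemma rateMatrix_le (hd : 0 < d) (hdeg : ∀ v, d ≤ (H.degree v : ℝ)) (u w : Fin n) :
    rateMatrix H u w ≤ 2 / d := by
  unfold rateMatrix
  split_ifs
  · calc (H.degree u : ℝ)⁻¹ + (H.degree w : ℝ)⁻¹ ≤ d⁻¹ + d⁻¹ := by gcongr <;> exact hdeg _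
      _ = 2 / d := by ring
  · positivity

lemma degInto_div_le_sum_rateMatrix (S : Finset (Fin n)) (w : Fin n) :
    degInto H S w / n ≤ ∑ u ∈ S, rateMatrix H w u := by
  rw [degInto, Finset.sum_div]
  refine Finset.sum_le_sum fun u _ => ?_
  unfold rateMatrix
  split_ifs with hadj
  · have hu : (0 : ℝ) < H.degree u := by
      exact_mod_cast (H.degree_pos_iff_exists_adj u).2 ⟨w, hadj.symm⟩
    have hun : (H.degree u : ℝ) ≤ n := by
      exact_mod_cast (H.degree_lt_card_verts u).le.trans_eq (Fintype.card_fin n)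
    rw [one_div]
    exact (inv_anti₀ hu hun).trans (le_add_of_nonneg_left (by positivity))
  · simp

lemma sum_compl_degInto_le {β : ℝ} (hβ : 0 ≤ β) (S : Finset (Fin n)) :
    ∑ w ∈ Sᶜ, degInto H S w ≤
      ((Sᶜ.filter fun w => β * n ≤ degInto H S w).card + β * n) * n := by
  rw [← Finset.sum_filter_add_sum_filter_not Sᶜ fun w => β * n ≤ degInto H S w, add_mul]
  gcongr
  · rw [← nsmul_eq_mul]
    exact Finset.sum_le_card_nsmul _ _ _ fun w _ =>
      (degInto_le_card S w).trans (by exact_mod_cast card_finset_fin_le S)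
  · calc _ ≤ (Sᶜ.filter fun w => ¬ β * n ≤ degInto H S w).card • (β * n) :=
          Finset.sum_le_card_nsmul _ _ _ fun w hw => (not_le.1 (Finset.mem_filter.1 hw).2).le
      _ ≤ n • (β * n) := by
          gcongr
          exact card_finset_fin_le _
      _ = β * n * n := by rw [nsmul_eq_mul, mul_comm]

lemma HasEdgeExpansion.isSpreading_rateMatrix {c β : ℝ} (hH : HasEdgeExpansion H (c * n))
    (hn : 0 < n) (hc : 0 ≤ c) (hβ : 0 ≤ β) (hdeg : ∀ v, 2 * (d * n) ≤ (H.degree v : ℝ))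
    (hβd : β ≤ d) (hβcd : 2 * β ≤ c * d) : IsSpreading (rateMatrix H) (d * n) β := by
  have hn₀ : (0 : ℝ) < n := by exact_mod_cast hn
  have hrow : ∀ (S : Finset (Fin n)) w, β * n ≤ degInto H S w →
      β ≤ ∑ u ∈ S, rateMatrix H w u := fun S w hw =>
    ((le_div_iff₀ hn₀).2 hw).trans (degInto_div_le_sum_rateMatrix S w)
  have hβdn : β * n ≤ d * n := by gcongr
  intro S hS
  rw [Fintype.card_fin]
  by_cases hsmall : (Sᶜ.card : ℝ) < d * n
  · refine ⟨Finset.univ, Finset.subset_univ _, fun w _ => Or.inr (hrow S w ?_), Or.inl rfl⟩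
    linarith [degInto_add_compl (G := H) S w, degInto_le_card (G := H) Sᶜ w, hdeg w]
  · set N := Sᶜ.filter fun w => β * n ≤ degInto H S w
    have hdisj : Disjoint S N :=
      Finset.disjoint_of_subset_right (Finset.filter_subset _ _) disjoint_compl_right
    refine ⟨S ∪ N, Finset.subset_union_left, fun w hw => ?_, Or.inr ?_⟩
    · exact (Finset.mem_union.1 hw).imp_right fun hwN : w ∈ N =>
        hrow S w (Finset.mem_filter.1 hwN).2
    · have hcut : 2 * β * n * n ≤ (N.card + β * n) * n :=
        calc 2 * β * n * n ≤ c * d * n * n := by gcongr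
          _ = c * n * (d * n) := by ring
          _ ≤ c * n * min (S.card : ℝ) (Sᶜ.card : ℝ) := by
              gcongr
              exact le_min hS (not_lt.1 hsmall)
          _ ≤ (N.card + β * n) * n := (hH S).trans (sum_compl_degInto_le hβ S)
      have hNcard := le_of_mul_le_mul_right hcut hn₀
      rw [Finset.card_union_of_disjoint hdisj]
      push_cast
      linarith

end RateMatrix

section PushPullGrowth

open Matrix

variable {n : ℕ} {H : SimpleGraph (Fin n)} [DecidableRel H.Adj] {q : unitInterval}
  {φ : Fin n → ℝ} {d : ℝ}

lemma sum_mul_contactRate_sub_le (pull : Bool) (hφ : ∀ w, 0 ≤ φ w) {J : Finset (Fin n)} {η : ℝ}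
    (hη : ∀ w, contactRate H q pull J w ≤ η) (hη₀ : 0 ≤ η) :
    ∑ w, φ w * contactRate H q pull J w - η * ∑ w ∈ J, φ w ≤
      (1 + η) * expectedGain H q pull φ J := by
  have hinside : ∑ w ∈ J, φ w * contactRate H q pull J w ≤ η * ∑ w ∈ J, φ w := by
    rw [Finset.mul_sum]
    exact Finset.sum_le_sum fun w _ =>
      (mul_le_mul_of_nonneg_left (hη w) (hφ w)).trans_eq (mul_comm _ _)
  have houtside : ∑ w ∈ Jᶜ, φ w * contactRate H q pull J w ≤
      (1 + η) * expectedGain H q pull φ J := by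
    rw [expectedGain, Finset.mul_sum]
    refine Finset.sum_le_sum fun w hw => ?_
    rw [mul_left_comm]
    refine mul_le_mul_of_nonneg_left ?_ (hφ w)
    have hrate := contactRate_nonneg (G := H) (q := q) pull J w
    rw [← div_le_iff₀' (by positivity)]
    exact (div_le_div_of_nonneg_left hrate (by positivity) (by linarith [hη w])).trans
      (contactRate_div_one_add_le_informProb (Finset.mem_compl.1 hw))
  linarith [Finset.sum_add_sum_compl J fun w => φ w * contactRate H q pull J w]

lemma IsSubsolution.mul_sum_le_sum_mul_contactRate {l : ℝ} (hφ : IsSubsolution (rateMatrix H) l φ)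
    (hpos : ∀ v, 0 < H.degree v) (J : Finset (Fin n)) :
    l * q * ∑ w ∈ J, φ w ≤ ∑ w, φ w * contactRate H q true J w := by
  have hq₀ : (0 : ℝ) ≤ q := q.2.1
  calc l * q * ∑ w ∈ J, φ w = q * ∑ u ∈ J, l * φ u := by rw [← Finset.mul_sum]; ring
    _ ≤ q * ∑ u ∈ J, (rateMatrix H *ᵥ φ) u := by
        gcongr
        exact hφ.mul_le _
    _ = ∑ w, φ w * contactRate H q true J w := by
        simp only [contactRate_true_eq hpos, mulVec, dotProduct]
        rw [Finset.sum_comm, Finset.mul_sum]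
        refine Finset.sum_congr rfl fun w _ => ?_
        rw [← Finset.sum_mul, Finset.sum_congr rfl fun u _ => rateMatrix_comm H u w]
        ring

lemma contactRate_true_le (hd : 0 < d) (hdeg : ∀ v, d ≤ (H.degree v : ℝ)) (J : Finset (Fin n))
    (w : Fin n) : contactRate H q true J w ≤ J.card * (2 / d) := by
  rw [contactRate_true_eq (degree_pos_of_le hd hdeg)]
  calc (q : ℝ) * ∑ u ∈ J, rateMatrix H w u ≤ ∑ u ∈ J, rateMatrix H w u :=
        mul_le_of_le_one_left (Finset.sum_nonneg fun u _ => rateMatrix_nonneg H w u) q.2.2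
    _ ≤ J.card • (2 / d) := Finset.sum_le_card_nsmul _ _ _ fun u _ => rateMatrix_le hd hdeg w u
    _ = J.card * (2 / d) := nsmul_eq_mul _ _

lemma IsSubsolution.hasGrowth_pushPull (hφ : IsSubsolution (rateMatrix H) 2 φ) (hd : 0 < d)
    (hdeg : ∀ v, d ≤ (H.degree v : ℝ)) {ξ : ℝ} (hξ : 0 < ξ) :
    HasGrowth H q true φ (2 * q - ξ) (ξ / 6 * d) := by
  intro J hJ
  have hrate : ∀ w, contactRate H q true J w ≤ ξ / 3 := fun w =>
    calc contactRate H q true J w ≤ J.card * (2 / d) := contactRate_true_le hd hdeg J w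
      _ ≤ ξ / 6 * d * (2 / d) := by gcongr
      _ = ξ / 3 := by field_simp; norm_num
  have hgain := sum_mul_contactRate_sub_le true hφ.nonneg hrate (by positivity)
  have htotal := hφ.mul_sum_le_sum_mul_contactRate (q := q) (degree_pos_of_le hd hdeg) J
  have hweight : 0 ≤ ∑ w ∈ J, φ w := Finset.sum_nonneg fun w _ => hφ.nonneg w
  have hfactor : (1 + ξ / 3) * (2 * q - ξ) ≤ 2 * q - ξ / 3 := by nlinarith [q.2.2]
  refine le_of_mul_le_mul_left ?_ (show 0 < 1 + ξ / 3 by positivity)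
  calc (1 + ξ / 3) * ((2 * q - ξ) * ∑ w ∈ J, φ w)
      = (1 + ξ / 3) * (2 * q - ξ) * ∑ w ∈ J, φ w := by ring
    _ ≤ (2 * q - ξ / 3) * ∑ w ∈ J, φ w := by gcongr
    _ ≤ (1 + ξ / 3) * expectedGain H q true φ J := by linarith

lemma exists_isSubsolution_rateMatrix {α c β : ℝ} (hn : 0 < n) (hα : 0 < α) (hα₁ : α ≤ 1)
    (hc : 0 ≤ c) (hβ₀ : 0 < β) (hβα : β ≤ α / 4) (hβc : 2 * β ≤ c * (α / 4))
    (hdeg : ∀ v, α / 2 * n ≤ (H.degree v : ℝ)) (hH : HasEdgeExpansion H (c * n)) :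
    ∃ φ, IsSubsolution (rateMatrix H) 2 φ ∧
      ∀ w, φ w ∈ Set.Icc (β ^ ⌈β⁻¹⌉₊ * 2⁻¹) ((1 + 4 / α) ^ ⌈β⁻¹⌉₊ * (4 / α / 2)) := by
  have : (0 : ℝ) < n := by exact_mod_cast hn
  have hd : 0 < α / 2 * n := by positivity
  have : Nonempty (Fin n) := ⟨⟨0, hn⟩⟩
  have hspread : IsSpreading (rateMatrix H) (α / 4 * n) β :=
    hH.isSpreading_rateMatrix hn hc hβ₀.le (fun v => le_trans (by linarith) (hdeg v)) hβα hβc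
  refine exists_isSubsolution_forall_mem_Icc (isHermitian_rateMatrix H) (rateMatrix_nonneg H)
    two_pos (fun u w => ?_) (by positivity) ?_ hβ₀ (by linarith) ?_
  · rw [Fintype.card_fin]
    exact (rateMatrix_le hd hdeg u w).trans_eq (by field_simp; norm_num)
  · rw [Fintype.card_fin, sum_rateMatrix (degree_pos_of_le hd hdeg)]
  · rw [Fintype.card_fin]
    convert hspread using 2
    field_simp

end PushPullGrowth

namespace IsExpanderSequence

theorem exists_eventually_hasGrowth_pushPull {G H : (n : ℕ) → SimpleGraph (Fin n)}
    [∀ n, DecidableRel (G n).Adj] [∀ n, DecidableRel (H n).Adj] {ε α : ℝ}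
    (hG : IsExpanderSequence G) (hε : 0 < ε) (hε₁ : ε < 1 / 2)
    (hH : ∀ n, IsDeletion (1 / 2 + ε) (G n) (H n)) (hα : 0 < α) (hα₁ : α ≤ 1)
    (hδ : ∀ᶠ n : ℕ in atTop, α * n ≤ ((G n).minDegree : ℝ)) (q : unitInterval) :
    ∃ a b : ℝ, 0 < a ∧ 0 < b ∧ ∀ ξ : ℝ, 0 < ξ → ∃ θ : ℝ, 0 < θ ∧
      ∀ᶠ n : ℕ in atTop, ∃ φ : Fin n → ℝ, (∀ w, a ≤ φ w) ∧ (∀ w, φ w ≤ b) ∧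
        HasGrowth (H n) q true φ (2 * q - ξ) (θ * n) := by
  set β := ε * α ^ 2 / 16
  have hβ₀ : 0 < β := by positivity
  have : ε * α ≤ 1 := by nlinarith
  refine ⟨β ^ ⌈β⁻¹⌉₊ * 2⁻¹, (1 + 4 / α) ^ ⌈β⁻¹⌉₊ * (4 / α / 2), by positivity, by positivity,
    fun ξ hξ => ⟨ξ / 6 * (α / 2), by positivity, ?_⟩⟩
  filter_upwards [hδ, hG.eventually_hasEdgeExpansion hε hε₁ hH, eventually_gt_atTop 0]
    with n hδn hexp hn
  have : (0 : ℝ) < n := by exact_mod_cast hn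
  have hdeg : ∀ v, α / 2 * n ≤ ((H n).degree v : ℝ) := fun v =>
    le_trans (by linarith) ((hH n).minDegree_div_two_le_degree hε v)
  have hexp' : HasEdgeExpansion (H n) (ε * α / 2 * n) := hexp.mono <| by
    have hΔ : α * n ≤ (G n).maxDegree :=
      hδn.trans (by exact_mod_cast (G n).minDegree_le_maxDegree)
    linarith [mul_le_mul_of_nonneg_left hΔ hε.le]
  obtain ⟨φ, hφ, hmem⟩ := exists_isSubsolution_rateMatrix hn hα hα₁ (by positivity) hβ₀
    (by simp only [β]; nlinarith) (by simp only [β]; linarith) hdeg hexp'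
  refine ⟨φ, fun w => (hmem w).1, fun w => (hmem w).2, ?_⟩
  rw [mul_assoc]
  exact hφ.hasGrowth_pushPull (by positivity) hdeg hξ

end IsExpanderSequence

section LowerBound

variable {n : ℕ} {H : SimpleGraph (Fin n)} [DecidableRel H.Adj] {q : unitInterval}

lemma expectedGain_push_le (hpos : ∀ v, 0 < H.degree v) (J : Finset (Fin n)) :
    expectedGain H q false (fun _ => 1) J ≤ q * J.card :=
  calc expectedGain H q false (fun _ => 1) J ≤ ∑ w ∈ Jᶜ, contactRate H q false J w :=
        Finset.sum_le_sum fun w hw => by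
          rw [one_mul]
          exact informProb_false_le (Finset.mem_compl.1 hw)
    _ ≤ ∑ w, contactRate H q false J w :=
        Finset.sum_le_sum_of_subset_of_nonneg (Finset.subset_univ _) fun w _ _ =>
          contactRate_nonneg false J w
    _ = q * J.card := sum_contactRate_false hpos J

lemma transition_push_card_le (hpos : ∀ v, 0 < H.degree v) (J : Finset (Fin n)) :
    transition (roundLaw H q) (protocolStep false) (fun J => (J.card : ℝ)) J ≤
      (1 + q) * J.card := by
  have hsum := transition_sum (G := H) (q := q) (pull := false) (φ := fun _ => 1) (I := J)
  simp only [Finset.sum_const, nsmul_eq_mul, mul_one] at hsum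
  linarith [expectedGain_push_le (q := q) hpos J]

lemma failProb_push_compl_le (hpos : ∀ v, 0 < H.degree v) {m : ℝ} (hm : 0 < m) (t : ℕ)
    (v : Fin n) :
    failProb (roundLaw H q) (protocolStep false) (largeSets n m)ᶜ t {v} ≤ m⁻¹ * (1 + q) ^ t := by
  have hq₀ : (0 : ℝ) ≤ q := q.2.1
  have hmarkov : ∀ J : Finset (Fin n),
      (largeSets n m)ᶜᶜ.indicator 1 J ≤ m⁻¹ * (J.card : ℝ) := fun J => by
    rw [compl_compl, inv_mul_eq_div]
    exact Set.indicator_apply_le' (fun hJ => (one_le_div hm).2 hJ) fun _ => by positivity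
  calc failProb (roundLaw H q) (protocolStep false) (largeSets n m)ᶜ t {v}
      ≤ (transition (roundLaw H q) (protocolStep false))^[t] (fun J => m⁻¹ * (J.card : ℝ)) {v} :=
        iterate_transition_mono (le_protocolStep false) (fun J _ => hmarkov J) t
    _ = m⁻¹ * (transition (roundLaw H q) (protocolStep false))^[t] (fun J => (J.card : ℝ)) {v} := by
        rw [iterate_transition_const_mul]
    _ ≤ m⁻¹ * ((1 + q) ^ t * (({v} : Finset (Fin n)).card : ℝ)) := by
        gcongr
        exact iterate_transition_le_pow_mul (le_protocolStep false) (by positivity)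
          (fun J _ => transition_push_card_le hpos J) t
    _ = m⁻¹ * (1 + q) ^ t := by simp

end LowerBound

lemma pow_floor_logb_sub_le {b x : ℝ} (hb : 1 < b) (hx : 0 < x) (y : ℝ) :
    b ^ ⌊Real.logb b x - y⌋₊ ≤ 1 + x * Real.exp (-(Real.log b * y)) := by
  have hb₀ : 0 < b := one_pos.trans hb
  have hrpow : b ^ (Real.logb b x - y) = x * Real.exp (-(Real.log b * y)) := by
    rw [Real.rpow_sub hb₀, Real.rpow_logb hb₀ hb.ne' hx, Real.rpow_def_of_pos hb₀, Real.exp_neg,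
      div_eq_mul_inv]
  have hexp : 0 < x * Real.exp (-(Real.log b * y)) := by positivity
  rcases le_total 0 (Real.logb b x - y) with hnonneg | hnonpos
  · have hfloor := Real.rpow_le_rpow_of_exponent_le hb.le (Nat.floor_le hnonneg)
    rw [Real.rpow_natCast, hrpow] at hfloor
    linarith
  · rw [Nat.floor_of_nonpos hnonpos, pow_zero]
    linarith

theorem eventually_failProb_push_compl_le (H : (n : ℕ) → SimpleGraph (Fin n))
    [∀ n, DecidableRel (H n).Adj] {q : unitInterval} (hq : 0 < q)
    (hpos : ∀ᶠ n in atTop, ∀ v, 0 < (H n).degree v) {κ η : ℝ} (hκ : 0 < κ) (hη : 0 < η) :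
    ∀ᶠ n : ℕ in atTop, ∀ v : Fin n,
      failProb (roundLaw (H n) q) (protocolStep false) (largeSets n (n - n / Real.log n))ᶜ
        ⌊Real.logb (1 + q) n - κ * Real.log n⌋₊ {v} ≤ η := by
  have hq₁ : (1 : ℝ) < 1 + q := lt_add_of_pos_right 1 hq
  have hlim : Tendsto (fun n : ℕ => 2 * (n : ℝ)⁻¹ +
      2 * Real.exp (-(Real.log (1 + q) * (κ * Real.log n)))) atTop (𝓝 0) := by
    have hinv := (tendsto_inv_atTop_zero.comp (tendsto_natCast_atTop_atTop (R := ℝ))).const_mul 2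
    have hexp := (Real.tendsto_exp_neg_atTop_nhds_zero.comp <|
      (tendsto_log_natCast_atTop.const_mul_atTop hκ).const_mul_atTop (Real.log_pos hq₁)).const_mul 2
    simpa using hinv.add hexp
  filter_upwards [hlim.eventually_le_const hη, hpos,
    tendsto_log_natCast_atTop.eventually_ge_atTop 2, eventually_gt_atTop 0]
    with n hle hposn hlog hn v
  have hn₀ : (0 : ℝ) < n := by exact_mod_cast hn
  have hhalf : (n : ℝ) / 2 ≤ n - n / Real.log n := by
    have := div_le_div_of_nonneg_left hn₀.le two_pos hlog
    linarith
  refine (failProb_push_compl_le hposn ((half_pos hn₀).trans_le hhalf) _ v).trans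
    (le_trans ?_ hle)
  calc (n - n / Real.log n)⁻¹ * (1 + (q : ℝ)) ^ ⌊Real.logb (1 + q) n - κ * Real.log n⌋₊
      ≤ ((n : ℝ) / 2)⁻¹ * (1 + n * Real.exp (-(Real.log (1 + q) * (κ * Real.log n)))) := by
        gcongr
        exact pow_floor_logb_sub_le hq₁ hn₀ _
    _ = 2 * (n : ℝ)⁻¹ + 2 * Real.exp (-(Real.log (1 + q) * (κ * Real.log n))) := by field_simp

section AlmostAllTime

variable {n : ℕ} {H : SimpleGraph (Fin n)} [DecidableRel H.Adj] {q : unitInterval}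
  {step : Finset (Fin n) → Calls n → Finset (Fin n)} {v : Fin n} {ω : ℕ → Calls n} {t : ℕ}

lemma exists_almostAllTime_eq (hstep : ∀ I c, I ≤ step I c)
    (hmem : informed step v ω t ∈ largeSets n (n - n / Real.log n)) :
    ∃ t' : ℕ, almostAllTime step v ω = t' ∧ t' ≤ t ∧
      ∀ s, informed step v ω s ∉ largeSets n (n - n / Real.log n) → s < t' := by
  classical
  have hex : ∃ t, informed step v ω t ∈ largeSets n (n - n / Real.log n) := ⟨t, hmem⟩
  refine ⟨Nat.find hex, le_antisymm (iInf₂_le_of_le _ (Nat.find_spec hex) le_rfl)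
    (le_iInf₂ fun s hs => by exact_mod_cast Nat.find_min' hex hs), Nat.find_min' hex hmem,
    fun s hs => ?_⟩
  by_contra! hle
  exact hs (isUpperSet_largeSets n _ (monotone_informed hstep ω hle) (Nat.find_spec hex))

lemma one_sub_measureReal_le_of_compl_subset {Ω : Type*} [MeasurableSpace Ω] {μ : Measure Ω}
    [IsProbabilityMeasure μ] {s t : Set Ω} (h : sᶜ ⊆ t) : 1 - μ.real s ≤ μ.real t := by
  have hcover : s ∪ t = Set.univ := Set.compl_subset_iff_union.1 h
  have hunion := measureReal_union_le (μ := μ) s t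
  rw [hcover, probReal_univ] at hunion
  linarith

lemma callsLaw_real_informed_notMem (A : Set (Finset (Fin n))) :
    (callsLaw H q).real {ω | informed step v ω t ∉ A} = failProb (roundLaw H q) step A t {v} :=
  measureReal_informed_notMem _ t A

lemma one_sub_failProb_le_callsLaw_almostAllTime (hstep : ∀ I c, I ≤ step I c) {b : ℝ}
    (ht : (t : ℝ) ≤ b) :
    1 - failProb (roundLaw H q) step (largeSets n (n - n / Real.log n)) t {v} ≤
      (callsLaw H q).real {ω | ∃ t' : ℕ, almostAllTime step v ω = t' ∧ (t' : ℝ) ≤ b} := by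
  rw [← callsLaw_real_informed_notMem]
  refine one_sub_measureReal_le_of_compl_subset fun ω hω => ?_
  obtain ⟨t', htime, hle, -⟩ := exists_almostAllTime_eq hstep (not_not.1 hω)
  exact ⟨t', htime, le_trans (by exact_mod_cast hle) ht⟩

lemma one_sub_failProb_add_le_callsLaw_almostAllTime (hstep : ∀ I c, I ≤ step I c) {a b : ℝ}
    (ht : (t : ℝ) ≤ b) :
    1 - (failProb (roundLaw H q) step (largeSets n (n - n / Real.log n)) t {v} +
        failProb (roundLaw H q) step (largeSets n (n - n / Real.log n))ᶜ ⌊a⌋₊ {v}) ≤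
      (callsLaw H q).real
        {ω | ∃ t' : ℕ, almostAllTime step v ω = t' ∧ a ≤ t' ∧ (t' : ℝ) ≤ b} := by
  simp only [← callsLaw_real_informed_notMem]
  refine (sub_le_sub_left (measureReal_union_le _ _) 1).trans
    (one_sub_measureReal_le_of_compl_subset fun ω hω => ?_)
  rw [Set.compl_union] at hω
  obtain ⟨t', htime, hle, hlt⟩ := exists_almostAllTime_eq hstep (not_not.1 hω.1)
  refine ⟨t', htime, ?_, le_trans (by exact_mod_cast hle) ht⟩
  exact (Nat.lt_of_floor_lt (hlt _ (not_not.1 hω.2))).le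

end AlmostAllTime

section Diagonal

lemma exists_tendsto_zero_of_forall_eventually {P : ℝ → ℕ → Prop}
    (h : ∀ κ, 0 < κ → ∀ᶠ n in atTop, P κ n) :
    ∃ κ : ℕ → ℝ, (∀ n, 0 < κ n) ∧ Tendsto κ atTop (𝓝 0) ∧ ∀ᶠ n in atTop, P (κ n) n := by
  classical
  have hthreshold : ∀ k : ℕ, ∃ N, ∀ n ≥ N, P (1 / ((k : ℝ) + 1)) n := fun k =>
    eventually_atTop.1 (h _ (by positivity))
  choose N hN using hthreshold
  let k : ℕ → ℕ := fun n => Nat.findGreatest (fun k => N k ≤ n) n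
  have hk : Tendsto k atTop atTop := tendsto_atTop.2 fun K => by
    filter_upwards [eventually_ge_atTop K, eventually_ge_atTop (N K)] with n hKn hNn
    exact Nat.le_findGreatest hKn hNn
  refine ⟨fun n => 1 / ((k n : ℝ) + 1), fun n => by positivity,
    tendsto_one_div_add_atTop_nhds_zero_nat.comp hk, ?_⟩
  filter_upwards [eventually_ge_atTop (N 0)] with n hn
  exact hN _ _ (Nat.findGreatest_spec (P := fun k => N k ≤ n) (Nat.zero_le n) hn)

lemma exists_isLittleO_log {Q : (g : ℝ) → (n : ℕ) → Fin n → ℝ}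
    (h : ∀ κ, 0 < κ → ∀ᶠ n : ℕ in atTop, ∀ v : Fin n, 1 - κ ≤ Q (κ * Real.log n) n v) :
    ∃ g : ℕ → ℝ, (∀ n, 0 < g n) ∧ g =o[atTop] (fun n : ℕ => Real.log n) ∧
      ∀ η : ℝ, 0 < η → ∀ᶠ n : ℕ in atTop, ∀ v : Fin n, 1 - η ≤ Q (g n) n v := by
  obtain ⟨κ, hκ, hκ₀, hP⟩ := exists_tendsto_zero_of_forall_eventually h
  have hg : (fun n : ℕ => if 2 ≤ n then κ n * Real.log n else 1) =ᶠ[atTop]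
      fun n => κ n * Real.log n := by
    filter_upwards [eventually_ge_atTop 2] with n hn
    rw [if_pos hn]
  refine ⟨fun n => if 2 ≤ n then κ n * Real.log n else 1, fun n => ?_, ?_, fun η hη => ?_⟩
  · beta_reduce
    split_ifs with hn
    · exact mul_pos (hκ n) (Real.log_pos (by exact_mod_cast hn))
    · exact one_pos
  · refine IsLittleO.congr' ?_ hg.symm EventuallyEq.rfl
    simpa using ((isLittleO_one_iff ℝ).2 hκ₀).mul_isBigO
      (isBigO_refl (fun n : ℕ => Real.log n) atTop)
  · filter_upwards [hP, hg, hκ₀.eventually_le_const hη] with n hPn hgn hκη v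
    rw [hgn]
    exact (sub_le_sub_left hκη 1).trans (hPn v)

end Diagonal

namespace IsExpanderSequence

variable {G H : (n : ℕ) → SimpleGraph (Fin n)} [∀ n, DecidableRel (G n).Adj]
  [∀ n, DecidableRel (H n).Adj] {ε : ℝ} {q : unitInterval}

lemma eventually_forall_degree_pos (hG : IsExpanderSequence G) (hε : 0 < ε)
    (hH : ∀ n, IsDeletion (1 / 2 + ε) (G n) (H n)) :
    ∀ᶠ n in atTop, ∀ v, 0 < (H n).degree v := by
  filter_upwards [hG.eventually_minDegree_pos] with n hδ
  exact degree_pos_of_le (half_pos hδ) ((hH n).minDegree_div_two_le_degree hε)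

lemma eventually_exists_time_failProb_le (hG : IsExpanderSequence G) (hε : 0 < ε)
    (hε₁ : ε < 1 / 2) (hH : ∀ n, IsDeletion (1 / 2 + ε) (G n) (H n)) (hq : 0 < q) (pull : Bool)
    {γ a b : ℝ} (hγ : 0 < γ) (ha : 0 < a) (hb : 0 < b)
    (hgrow : ∀ ξ : ℝ, 0 < ξ → ∃ θ : ℝ, 0 < θ ∧ ∀ᶠ n : ℕ in atTop, ∃ φ : Fin n → ℝ,
      (∀ w, a ≤ φ w) ∧ (∀ w, φ w ≤ b) ∧ HasGrowth (H n) q pull φ (γ - ξ) (θ * n))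
    {κ η : ℝ} (hκ : 0 < κ) (hη : 0 < η) :
    ∀ᶠ n : ℕ in atTop, ∃ t : ℕ, (t : ℝ) ≤ Real.logb (1 + γ) n + κ * Real.log n ∧
      ∀ v : Fin n, failProb (roundLaw (H n) q) (protocolStep pull)
        (largeSets n (n - n / Real.log n)) t {v} ≤ η := by
  have hq₀ : (0 : ℝ) < q := hq
  have hq₁ : (q : ℝ) ≤ 1 := q.2.2
  filter_upwards [eventually_exists_time_failProb_almostAll_le H hγ ha hb (by positivity)
    (by nlinarith) (hG.eventually_hasCutGain hε hε₁ hH q pull) hgrow hκ hη] with n ⟨t, ht, hfail⟩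
  exact ⟨t, ht.trans_eq (by rw [Real.logb, div_eq_inv_mul, add_mul]), hfail⟩

theorem eventually_callsLaw_almostAllTime_push (hG : IsExpanderSequence G) (hε : 0 < ε)
    (hε₁ : ε < 1 / 2) (hH : ∀ n, IsDeletion (1 / 2 + ε) (G n) (H n)) (hq : 0 < q)
    {κ η : ℝ} (hκ : 0 < κ) (hη : 0 < η) :
    ∀ᶠ n : ℕ in atTop, ∀ v : Fin n, 1 - η ≤ (callsLaw (H n) q).real
      {ω | ∃ t : ℕ, almostAllTime pushStep v ω = t ∧
        Real.logb (1 + q) n - κ * Real.log n ≤ t ∧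
        (t : ℝ) ≤ Real.logb (1 + q) n + κ * Real.log n} := by
  have hupper := hG.eventually_exists_time_failProb_le hε hε₁ hH hq false hq one_pos one_pos
    (fun ξ hξ => ⟨ξ / 24, by positivity, (hG.eventually_hasGrowth_push hε hH q hξ).mono fun n hn =>
      ⟨fun _ => 1, fun _ => le_rfl, fun _ => le_rfl, hn⟩⟩) hκ (half_pos hη)
  have hlower := eventually_failProb_push_compl_le H hq (hG.eventually_forall_degree_pos hε hH) hκ
    (half_pos hη)
  filter_upwards [hupper, hlower] with n ⟨t, ht, hlate⟩ hearly v
  rw [pushStep_eq_protocolStep]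
  exact le_trans (by linarith [hlate v, hearly v])
    (one_sub_failProb_add_le_callsLaw_almostAllTime (le_protocolStep false) ht)

theorem eventually_callsLaw_almostAllTime_pushPull (hG : IsExpanderSequence G) (hε : 0 < ε)
    (hε₁ : ε < 1 / 2) (hH : ∀ n, IsDeletion (1 / 2 + ε) (G n) (H n)) (hq : 0 < q) {α : ℝ}
    (hα : 0 < α) (hα₁ : α ≤ 1) (hδ : ∀ᶠ n : ℕ in atTop, α * n ≤ ((G n).minDegree : ℝ))
    {κ η : ℝ} (hκ : 0 < κ) (hη : 0 < η) :
    ∀ᶠ n : ℕ in atTop, ∀ v : Fin n, 1 - η ≤ (callsLaw (H n) q).real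
      {ω | ∃ t : ℕ, almostAllTime pushPullStep v ω = t ∧
        (t : ℝ) ≤ Real.logb (1 + 2 * q) n + κ * Real.log n} := by
  obtain ⟨a, b, ha, hb, hgrow⟩ :=
    hG.exists_eventually_hasGrowth_pushPull hε hε₁ hH hα hα₁ hδ q
  filter_upwards [hG.eventually_exists_time_failProb_le hε hε₁ hH hq true
    (mul_pos two_pos hq) ha hb hgrow hκ hη] with n ⟨t, ht, hlate⟩ v
  rw [pushPullStep_eq_protocolStep]
  exact (sub_le_sub_left (hlate v) 1).trans
    (one_sub_failProb_le_callsLaw_almostAllTime (le_protocolStep true) ht)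

end IsExpanderSequence

end RumourSpreading

open RumourSpreading in
theorem mainTheorem4 (ε : ℝ) (hε₀ : 0 < ε) (hε₁ : ε < 1 / 2) (q : unitInterval) (hq : 0 < q)
    (G H : (n : ℕ) → SimpleGraph (Fin n))
    [∀ n, DecidableRel (G n).Adj] [∀ n, DecidableRel (H n).Adj]
    (hG : RumourSpreading.IsExpanderSequence G)
    (hH : ∀ n, RumourSpreading.IsDeletion (1 / 2 + ε) (G n) (H n)) :
    (∃ g : ℕ → ℝ, (∀ n, 0 < g n) ∧ g =o[atTop] (fun n : ℕ => Real.log n) ∧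
      ∀ η : ℝ, 0 < η → ∀ᶠ n : ℕ in atTop, ∀ v : Fin n,
        1 - η ≤ (RumourSpreading.callsLaw (H n) q).real
          {ω | ∃ t : ℕ, RumourSpreading.almostAllTime RumourSpreading.pushStep v ω = t ∧
            Real.logb (1 + q) n - g n ≤ t ∧ (t : ℝ) ≤ Real.logb (1 + q) n + g n}) ∧
    (∀ α : ℝ, 0 < α → α ≤ 1 → (∀ᶠ n : ℕ in atTop, α * n ≤ ((G n).minDegree : ℝ)) →
      ∃ g : ℕ → ℝ, (∀ n, 0 < g n) ∧ g =o[atTop] (fun n : ℕ => Real.log n) ∧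
      ∀ η : ℝ, 0 < η → ∀ᶠ n : ℕ in atTop, ∀ v : Fin n,
        1 - η ≤ (RumourSpreading.callsLaw (H n) q).real
          {ω | ∃ t : ℕ, RumourSpreading.almostAllTime RumourSpreading.pushPullStep v ω = t ∧
            (t : ℝ) ≤ Real.logb (1 + 2 * q) n + g n}) := by
  refine ⟨exists_isLittleO_log (Q := fun g n v => (callsLaw (H n) q).real
      {ω | ∃ t : ℕ, almostAllTime pushStep v ω = t ∧
        Real.logb (1 + q) n - g ≤ t ∧ (t : ℝ) ≤ Real.logb (1 + q) n + g}) fun κ hκ => ?_,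
    fun α hα hα₁ hδ => exists_isLittleO_log (Q := fun g n v => (callsLaw (H n) q).real
      {ω | ∃ t : ℕ, almostAllTime pushPullStep v ω = t ∧
        (t : ℝ) ≤ Real.logb (1 + 2 * q) n + g}) fun κ hκ => ?_⟩
  · exact hG.eventually_callsLaw_almostAllTime_push hε₀ hε₁ hH hq hκ hκ
  · exact hG.eventually_callsLaw_almostAllTime_pushPull hε₀ hε₁ hH hq hα hα₁ hδ hκ hκ
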